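/- **Theorem (No-go for composable classical-client single-qubit UBQC).** All objects depend on a security parameter $n\in\mathbb N$. Angles are elements of $\mathbb Z\frac{\pi}{4}=\{0,\frac{\pi}{4},\dots,\frac{7\pi}{4}\}$ (modulo $2\pi$), and $|\pm_\theta\rangle=\frac{1}{\sqrt2}(|0\rangle\pm e^{i\theta}|1\rangle)$. All parties are interactive systems given by finite sequences of quantum instruments on finite-dimensional memories. *RSP sub-protocol.* Let $(P_A,P_B)$ be a two-party protocol in which the parties exchange only classical messages, through a classical channel $\mathcal C$ (a number $k(n)$ of rounds with messages of $l(n)$ bits), and at the end of which $P_A$ outputs an angle $\theta\in\mathbb Z\frac{\pi}{4}$ and $P_B$ outputs a qubit. For a run with a given classical transcript, let $\rho_B$ be the density matrix of this qubit (all other registers are traced out). Assume that $(P_A,P_B)$ is correct: there are negligible functions $\epsilon_0,\mu$ such that for all $n$, with probability at least $1-\mu(n)$ over the run, the trace distance between $\rho_B$ and $|+_\theta\rangle\langle+_\theta|$ is at most $\epsilon_0(n)$. Nothing is assumed about the security of $(P_A,P_B)$. *The UBQC protocol.* $\pi_A$ takes an input $\phi\in\mathbb Z\frac{\pi}{4}$,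 runs $P_A$ to obtain $\theta$, draws a uniform $r\in\{0,1\}$, sends $\delta=\theta+r\pi+\phi$, receives a bit $s$, and outputs $\bar s=s\oplus r$. $\pi_B$ runs $P_B$ to obtain a qubit, receives $\delta$, measures the qubit in the basis $\{|+_\delta\rangle,|-_\delta\rangle\}$, and sends the outcome $s$. *The ideal resource $\mathcal S_{UBQC1}$.* It takes $\phi\in\mathbb Z\frac{\pi}{4}$ from the client, takes a bit $c$ and, if $c=1$, a deviation $\xi$ and a quantum state $\rho$ from the server, and outputs a bit $\bar s$ to the client only. If $c=0$, $\bar s$ is the outcome of measuring $|+\rangle$ in the basis $\{|+_\phi\rangle,|-_\phi\rangle\}$. If $c=1$, $\bar s=\xi(\rho,\phi)$, where $\xi$ may be any CPTP map with a classical one-bit output. The filter $\vdash^{c=0}$ sets $c=0$. A simulator $\sigma$ interacts with $\mathcal S_{UBQC1}$ through its server interface and offers on its outer side the classical server-side interface of $\pi_A\mathcal C$. *Conclusion.* $(\pi_A,\pi_B)$ is not composable: there is no simulator $\sigma$, not even a computationally unbounded one, such that, for negligible $\epsilon$, $$\pi_A\,\mathcal C\,\pi_B\approx_\epsilon\mathcal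 S_{UBQC1}\vdash^{c=0}\qquad\text{and}\qquad \pi_A\,\mathcal C\approx_\epsilon\mathcal S_{UBQC1}\,\sigma .$$ Here $\approx_\epsilon$, for a class of distinguishers, means that each family of distinguishers in the class has an advantage bounded by some negligible function of $n$ (which may depend on the family). The assertion holds in both of the following settings: 1. (computational) $P_B$ is implemented by quantum circuits of polynomial size, and the distinguishers are the (non-uniform) polynomial-size quantum circuits, over any gate set that contains $H$, $T=\mathrm{diag}(1,e^{i\pi/4})$ and CNOT; $P_A$ is arbitrary; 2. (information-theoretic) $P_A$, $P_B$ and the distinguishers are unbounded. -/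

import Mathlib

open scoped ComplexOrder Matrix

noncomputable section

namespace UBQC

/-! ### Quantum instruments and states -/

/-- Complete positivity of a linear map between matrix algebras: every amplification `id ⊗ Φ`
maps positive semidefinite matrices to positive semidefinite matrices. -/
def IsCompletelyPositive {ι κ : Type} (Φ : Matrix ι ι ℂ →ₗ[ℂ] Matrix κ κ ℂ) : Prop :=
  ∀ (m : ℕ) (R : Matrix (Fin m × ι) (Fin m × ι) ℂ), R.PosSemidef →
    Matrix.PosSemidef (Matrix.of fun p q : Fin m × κ =>
      Φ (Matrix.of fun i j => R (p.1, i) (q.1, j)) p.2 q.2)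

/-- A quantum instrument with a classical input `x : X`, a classical outcome `y : Y`, a quantum
input on `ℂ^ι` and a quantum output on `ℂ^κ`. On input `x` and state `ρ` the outcome is `y` with
probability `tr (op x y ρ)`, and the state is then `op x y ρ / tr (op x y ρ)`. -/
structure Instrument (X Y ι κ : Type) [Fintype Y] [Fintype ι] [Fintype κ] where
  op : X → Y → (Matrix ι ι ℂ →ₗ[ℂ] Matrix κ κ ℂ)
  cp : ∀ x y, IsCompletelyPositive (op x y)
  tp : ∀ x ρ, ∑ y, (op x y ρ).trace = ρ.trace

/-- Density matrices. -/
structure State (ι : Type) [Fintype ι] where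
  mat : Matrix ι ι ℂ
  posSemidef : mat.PosSemidef
  trace_eq_one : mat.trace = 1

/-- The trace norm: the sum of the singular values. -/
def traceNorm {ι : Type} [Fintype ι] [DecidableEq ι] (X : Matrix ι ι ℂ) : ℝ :=
  ∑ i, √((Matrix.isHermitian_conjTranspose_mul_self X).eigenvalues i)

/-- The trace distance of two density matrices. -/
def traceDist {ι : Type} [Fintype ι] [DecidableEq ι] (ρ σ : Matrix ι ι ℂ) : ℝ :=
  traceNorm (ρ - σ) / 2

lemma isCompletelyPositive_of_kraus {ι κ J : Type} [Fintype ι] [Fintype κ] [Fintype J]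
    (K : J → Matrix κ ι ℂ) (Φ : Matrix ι ι ℂ →ₗ[ℂ] Matrix κ κ ℂ)
    (h : ∀ ρ, Φ ρ = ∑ j, K j * ρ * (K j)ᴴ) : IsCompletelyPositive Φ := by
  intro m R hR
  have key : (Matrix.of fun p q : Fin m × κ =>
      Φ (Matrix.of fun i j => R (p.1, i) (q.1, j)) p.2 q.2) =
      ∑ j, (Matrix.of fun (p : Fin m × κ) (q : Fin m × ι) =>
          if p.1 = q.1 then K j p.2 q.2 else 0) * R *
        (Matrix.of fun (p : Fin m × κ) (q : Fin m × ι) =>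
          if p.1 = q.1 then K j p.2 q.2 else 0)ᴴ := by
    ext p q
    simp only [Matrix.of_apply, h, Matrix.sum_apply, Matrix.mul_apply,
      Matrix.conjTranspose_apply, Fintype.sum_prod_type]
    refine Finset.sum_congr rfl fun j _ => ?_
    rw [Finset.sum_eq_single q.1]
    · refine Finset.sum_congr rfl fun a _ => ?_
      rw [Finset.sum_eq_single p.1]
      · simp
      · intro b _ hb
        simp [Ne.symm hb]
      · simp
    · intro b _ hb
      simp [Ne.symm hb]
    · simp
  rw [key]
  exact Matrix.posSemidef_sum _ fun j _ => hR.mul_mul_conjTranspose_same _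

/-- The instrument with Kraus operators `K x y j`. -/
def Instrument.ofKraus {X Y ι κ J : Type} [Fintype Y] [Fintype ι] [DecidableEq ι] [Fintype κ]
    [Fintype J] (K : X → Y → J → Matrix κ ι ℂ)
    (hK : ∀ x, ∑ y, ∑ j, (K x y j)ᴴ * K x y j = 1) : Instrument X Y ι κ where
  op x y :=
    { toFun := fun ρ => ∑ j, K x y j * ρ * (K x y j)ᴴ
      map_add' := fun ρ ρ' => by simp [Matrix.mul_add, Matrix.add_mul, Finset.sum_add_distrib]
      map_smul' := fun c ρ => by simp [Finset.smul_sum] }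
  cp x y := isCompletelyPositive_of_kraus (K x y) _ fun _ => rfl
  tp x ρ := by
    have h1 : ∀ y j, (K x y j * ρ * (K x y j)ᴴ).trace = ((K x y j)ᴴ * K x y j * ρ).trace :=
      fun y j => by rw [Matrix.trace_mul_comm, Matrix.mul_assoc]
    have h2 : ρ.trace = ((∑ y, ∑ j, (K x y j)ᴴ * K x y j) * ρ).trace := by rw [hK, one_mul]
    rw [h2]
    simp only [LinearMap.coe_mk, AddHom.coe_mk, Matrix.trace_sum, h1, Finset.sum_mul]

/-! ### Angles and single-qubit measurements -/

/-- `Bits l` is `{0,1}^l`. -/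
abbrev Bits (l : ℕ) : Type := Fin l → Bool

/-- `t : Angle` stands for the angle `t π / 4`; a bit `r` contributes `r π`. -/
abbrev Angle : Type := ZMod 8

def bitAngle (r : Bool) : Angle := if r then 4 else 0

/-- `|+_θ⟩ = (|0⟩ + e^{iθ} |1⟩) / √2`. -/
def plusKet (θ : Angle) (b : Bool) : ℂ :=
  (1 / (√2 : ℝ) : ℂ) * (if b then Complex.exp (Complex.I * (θ.val * Real.pi / 4)) else 1)

/-- `|+_θ⟩⟨+_θ|`. -/
def plusProj (θ : Angle) : Matrix Bool Bool ℂ :=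
  Matrix.of fun i j => plusKet θ i * star (plusKet θ j)

/-- The probability of outcome `s` (`0` for `|+_δ⟩`, `1` for `|-_δ⟩ = |+_{δ+π}⟩`) when a qubit in
the (sub-normalised) state `ρ` is measured in the basis `{|+_δ⟩, |-_δ⟩}`. -/
def measProb (δ : Angle) (ρ : Matrix Bool Bool ℂ) (s : Bool) : ℝ :=
  (plusProj (δ + bitAngle s) * ρ).trace.re

/-! ### Interactive converters with classical communication -/

/-- `k` rounds of an interactive quantum converter, as a sequence of quantum instruments that pass
on an internal quantum memory; round `i` reads a classical message and writes another one. -/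
structure Machine (k : ℕ) (X Y : Type) [Fintype Y] where
  mem : Fin (k + 1) → Type
  memFintype : ∀ i, Fintype (mem i)
  step : (i : Fin k) → Instrument X Y (mem i.castSucc) (mem i.succ)

attribute [instance] Machine.memFintype

/-- The sub-normalised memory after reading `x` and writing `y`, from initial memory `ρ`; its
trace is the probability that `y` is written when `x` is read. -/
def Machine.run {k : ℕ} {X Y : Type} [Fintype Y] (W : Machine k X Y)
    (ρ : Matrix (W.mem 0) (W.mem 0) ℂ) (x : Fin k → X) (y : Fin k → Y) :
    (i : Fin (k + 1)) → Matrix (W.mem i) (W.mem i) ℂ :=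
  Fin.induction ρ fun i τ => (W.step i).op (x i) (y i) τ

/-- What the party that speaks first has received before its message number `i`: nothing at the
beginning, and then the latest reply. -/
def received {k : ℕ} {M : Type} (b : Fin k → M) : Fin (k + 1) → Option M :=
  Fin.cons none fun i => some (b i)

/-- The client's part `P_A` of a remote state preparation protocol over a classical channel. The
parties exchange messages `a₀, b₀, …, a_{k-1}, b_{k-1}` of `l` bits, the `aᵢ` written by the
client and the `bᵢ` by the server; at the end the client outputs `θ`. -/
structure Client (k l : ℕ) extends Machine k (Option (Bits l)) (Bits l) where
  init : State (mem 0)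
  out : Type
  outFintype : Fintype out
  final : Instrument (Option (Bits l)) Angle (mem (Fin.last k)) out

attribute [instance] Client.outFintype

/-- The probability that the client sends `a` and outputs `θ` if the server's messages are `b`. -/
def Client.prob {k l : ℕ} (A : Client k l) (b a : Fin k → Bits l) (θ : Angle) : ℝ :=
  (A.final.op (received b (Fin.last k)) θ
    (A.run A.init.mat (fun i => received b i.castSucc) a (Fin.last k))).trace.re

/-- The server's part `P_B`: at the end it outputs one qubit. -/
structure Server (k l : ℕ) extends Machine k (Bits l) (Bits l) where
  init : State (mem 0)
  final : Instrument Unit Unit (mem (Fin.last k)) Bool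

/-- The qubit that the server outputs when its messages are `b` and the client's are `a`,
sub-normalised: its trace is the probability that the server sends `b` if the client sends `a`. -/
def Server.output {k l : ℕ} (B : Server k l) (a b : Fin k → Bits l) : Matrix Bool Bool ℂ :=
  B.final.op () () (B.run B.init.mat a b (Fin.last k))

/-- The density matrix `ρ_B` of the server's qubit in a run with messages `a`, `b`. -/
def Server.outputState {k l : ℕ} (B : Server k l) (a b : Fin k → Bits l) :
    Matrix Bool Bool ℂ :=
  (B.output a b).trace⁻¹ • B.output a b

/-- The probability that a run of `P_A C P_B` has messages `a`, `b` and client output `θ`. -/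
def runProb {k l : ℕ} (A : Client k l) (B : Server k l) (a b : Fin k → Bits l) (θ : Angle) : ℝ :=
  A.prob b a θ * (B.output a b).trace.re

/-- Negligible functions of the security parameter. -/
def Negligible (ε : ℕ → ℝ) : Prop :=
  Asymptotics.SuperpolynomialDecay Filter.atTop (fun n : ℕ => (n : ℝ)) ε

/-- Correctness of `(P_A, P_B)`: with overwhelming probability over the run, the trace distance
between `ρ_B` and `|+_θ⟩⟨+_θ|` is negligible. -/
def CorrectRSP {k l : ℕ → ℕ} (A : ∀ n, Client (k n) (l n)) (B : ∀ n, Server (k n) (l n)) :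
    Prop :=
  ∃ ε μ : ℕ → ℝ, Negligible ε ∧ Negligible μ ∧ ∀ n,
    1 - μ n ≤ ∑ a : Fin (k n) → Bits (l n), ∑ b : Fin (k n) → Bits (l n), ∑ θ : Angle,
      if traceDist ((B n).outputState a b) (plusProj θ) ≤ ε n then runProb (A n) (B n) a b θ else 0

/-! ### Resources -/

/-- A resource with both interfaces accessible: `R φ b s a δ s'` is the probability that, on
client input `φ` and server-side inputs `b₀, …, b_{k-1}, s`, it produces the server-side outputs
`a₀, …, a_{k-1}, δ` and the client output `s'`. The order of events is
`φ, a₀, b₀, …, a_{k-1}, b_{k-1}, δ, s, s'`. -/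
abbrev Resource (k l : ℕ) : Type :=
  Angle → (Fin k → Bits l) → Bool → (Fin k → Bits l) → Angle → Bool → ℝ

/-- A resource of which only the client interface is left: the probability of `s'` given `φ`. -/
abbrev LocalResource : Type := Angle → Bool → ℝ

/-- `π_A C` : run `P_A` to get `θ`, draw `r`, send `δ = θ + rπ + φ`, receive `s`, and output
`s' = s ⊕ r`. -/
def clientResource {k l : ℕ} (A : Client k l) : Resource k l := fun φ b s a δ s' =>
  ∑ θ : Angle, ∑ r : Bool,
    if δ = θ + bitAngle r + φ ∧ s' = xor s r then A.prob b a θ / 2 else 0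

/-- `π_A C π_B` : the server runs `P_B` to get a qubit, measures it in the basis
`{|+_δ⟩, |-_δ⟩}`, and sends the outcome `s`. -/
def honestResource {k l : ℕ} (A : Client k l) (B : Server k l) : LocalResource := fun φ s' =>
  ∑ a : Fin k → Bits l, ∑ b : Fin k → Bits l, ∑ δ : Angle, ∑ s : Bool,
    clientResource A φ b s a δ s' * measProb δ (B.output a b) s

/-- The ideal resource of single-qubit blind computation: the probability of the client output
`s'` on client input `φ`. The server input is `none` if `c = 0`; then `s'` is the outcome of
measuring `|+⟩` in the basis `{|+_φ⟩, |-_φ⟩}`. It is `some ξ`, with a state `ρ`, if `c = 1`; then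
`s'` is the output of the deviation `ξ` on `ρ` and `φ`. Here `ρ` is sub-normalised: its trace is
the probability of the branch. -/
def sUBQC1 {ι : Type} [Fintype ι] (φ : Angle) :
    Option (Instrument Angle Bool ι Unit) → Matrix ι ι ℂ → Bool → ℝ
  | none, ρ, s' => ρ.trace.re * measProb φ (plusProj 0) s'
  | some ξ, ρ, s' => (ξ.op φ s' ρ).trace.re

/-- `S_UBQC1` with the filter that sets `c = 0`. -/
def filteredResource : LocalResource := fun φ s' => sUBQC1 φ none (1 : Matrix Unit Unit ℂ) s'

/-- A simulator: classical messages as in `π_A C` at its outer interface (it sends the `aᵢ` and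
`δ`, and receives the `bᵢ` and `s`), and at its inner interface the server input of `S_UBQC1`:
the bit `c` (`none` is `c = 0`, `some j` is `c = 1` with deviation `dev j`) and a quantum state.
As `S_UBQC1` returns nothing to the server side, this input is given at the end. -/
structure Simulator (k l : ℕ) extends Machine k (Option (Bits l)) (Bits l) where
  init : State (mem 0)
  mid : Type
  midFintype : Fintype mid
  sendAngle : Instrument (Option (Bits l)) Angle (mem (Fin.last k)) mid
  label : Type
  labelFintype : Fintype label
  reg : Type
  regFintype : Fintype reg
  finish : Instrument Bool (Option label) mid reg
  dev : label → Instrument Angle Bool reg Unit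

attribute [instance] Simulator.midFintype Simulator.labelFintype Simulator.regFintype

/-- `S_UBQC1 σ`. -/
def simulatedResource {k l : ℕ} (σ : Simulator k l) : Resource k l := fun φ b s a δ s' =>
  ∑ c : Option σ.label,
    sUBQC1 φ (c.map σ.dev)
      (σ.finish.op s c
        (σ.sendAngle.op (received b (Fin.last k)) δ
          (σ.run σ.init.mat (fun i => received b i.castSucc) a (Fin.last k)))) s'

/-! ### Distinguishers -/

/-- A distinguisher for resources with both interfaces accessible. -/
structure Distinguisher (k l : ℕ) extends Machine k (Bits l) (Bits l) where
  pre : Type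
  preFintype : Fintype pre
  init : State pre
  start : Instrument Unit Angle pre (mem 0)
  mid : Type
  midFintype : Fintype mid
  reply : Instrument Angle Bool (mem (Fin.last k)) mid
  out : Type
  outFintype : Fintype out
  finish : Instrument Bool Bool mid out

attribute [instance] Distinguisher.preFintype Distinguisher.midFintype Distinguisher.outFintype

/-- The probability that the distinguisher `D` outputs `1` when it interacts with `R`. -/
def Distinguisher.pr {k l : ℕ} (D : Distinguisher k l) (R : Resource k l) : ℝ :=
  ∑ φ : Angle, ∑ a : Fin k → Bits l, ∑ b : Fin k → Bits l, ∑ δ : Angle, ∑ s : Bool, ∑ s' : Bool,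
    R φ b s a δ s' *
      (D.finish.op s' true
        (D.reply.op δ s
          (D.run (D.start.op () φ D.init.mat) a b (Fin.last k)))).trace.re

/-- A distinguisher for resources with only the client interface. -/
structure LocalDistinguisher where
  pre : Type
  preFintype : Fintype pre
  init : State pre
  mid : Type
  midFintype : Fintype mid
  start : Instrument Unit Angle pre mid
  out : Type
  outFintype : Fintype out
  finish : Instrument Bool Bool mid out

attribute [instance] LocalDistinguisher.preFintype LocalDistinguisher.midFintype
  LocalDistinguisher.outFintype

/-- The probability that the distinguisher `D` outputs `1` when it interacts with `R`. -/
def LocalDistinguisher.pr (D : LocalDistinguisher) (R : LocalResource) : ℝ :=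
  ∑ φ : Angle, ∑ s' : Bool,
    R φ s' * (D.finish.op s' true (D.start.op () φ D.init.mat)).trace.re

/-- `R ≈_ε S` with `ε` negligible, for a class `𝒟` of families of distinguishers. -/
def Indist {k l : ℕ → ℕ} (𝒟 : Set (∀ n, Distinguisher (k n) (l n)))
    (R S : ∀ n, Resource (k n) (l n)) : Prop :=
  ∀ D ∈ 𝒟, ∃ ε : ℕ → ℝ, Negligible ε ∧ ∀ n, |(D n).pr (R n) - (D n).pr (S n)| ≤ ε n

/-- `R ≈_ε S` with `ε` negligible, for resources with only the client interface. -/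
def LocalIndist (𝒟 : Set (ℕ → LocalDistinguisher)) (R S : ℕ → LocalResource) : Prop :=
  ∀ D ∈ 𝒟, ∃ ε : ℕ → ℝ, Negligible ε ∧ ∀ n, |(D n).pr (R n) - (D n).pr (S n)| ≤ ε n

/-- `σ` witnesses that `π_A, π_B` composably constructs `S_UBQC1` from the classical channel with
negligible error: correctness and security, for the given classes of distinguishers. -/
def IsComposablyRealizedBy {k l : ℕ → ℕ} (𝒟₀ : Set (ℕ → LocalDistinguisher))
    (𝒟 : Set (∀ n, Distinguisher (k n) (l n)))
    (A : ∀ n, Client (k n) (l n)) (B : ∀ n, Server (k n) (l n))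
    (σ : ∀ n, Simulator (k n) (l n)) : Prop :=
  LocalIndist 𝒟₀ (fun n => honestResource (A n) (B n)) (fun _ => filteredResource) ∧
    Indist 𝒟 (fun n => clientResource (A n)) (fun n => simulatedResource (σ n))

/-! ### Quantum circuits -/

/-- The computational basis of `N` qubits. -/
abbrev Qubits (N : ℕ) : Type := Fin N → Bool

/-- A gate set: for each `m`, the available gates on `m` qubits. -/
abbrev GateSet : Type := (m : ℕ) → Set (Matrix.unitaryGroup (Qubits m) ℂ)

/-- `g` acts as a gate of the set on some of the `N` wires and as the identity on the others. -/
def IsElementary (𝒢 : GateSet) {N : ℕ} (g : Matrix.unitaryGroup (Qubits N) ℂ) : Prop :=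
  ∃ (m : ℕ) (U : Matrix.unitaryGroup (Qubits m) ℂ) (w : Fin m ↪ Fin N), U ∈ 𝒢 m ∧
    ∀ x y : Qubits N, ((∀ j, j ∉ Set.range w → x j = y j) → g.1 x y = U.1 (x ∘ w) (y ∘ w)) ∧
      ((∃ j, j ∉ Set.range w ∧ x j ≠ y j) → g.1 x y = 0)

/-- The gate set contains the Hadamard gate, the gate `T = diag(1, e^{iπ/4})`, and CNOT. -/
structure ContainsCliffordT (𝒢 : GateSet) : Prop where
  hadamard : ∃ U ∈ 𝒢 1, ∀ x y : Qubits 1,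
    U.1 x y = (1 / (√2 : ℝ) : ℂ) * (if x 0 && y 0 then -1 else 1)
  tGate : ∃ U ∈ 𝒢 1, ∀ x y : Qubits 1,
    U.1 x y = if x = y then (if x 0 then Complex.exp (Complex.I * (Real.pi / 4)) else 1) else 0
  cnot : ∃ U ∈ 𝒢 2, ∀ x y : Qubits 2,
    U.1 x y = if x 0 = y 0 ∧ x 1 = xor (y 0) (y 1) then 1 else 0

/-- A circuit on `N` qubits, as the list of its gates in the order in which they are applied. -/
structure Circuit (𝒢 : GateSet) (N : ℕ) where
  gates : List (Matrix.unitaryGroup (Qubits N) ℂ)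
  elementary : ∀ g ∈ gates, IsElementary 𝒢 g

/-- The unitary of a circuit. -/
def Circuit.unitary {𝒢 : GateSet} {N : ℕ} (C : Circuit 𝒢 N) :
    Matrix.unitaryGroup (Qubits N) ℂ :=
  C.gates.reverse.prod

/-- The Kraus operator, for the measured content `z`, of overwriting the register `w` by `x`. -/
def loadOp {N p : ℕ} (w : Fin p ↪ Fin N) (x z : Bits p) : Matrix (Qubits N) (Qubits N) ℂ :=
  Matrix.of fun u v =>
    if v ∘ w = z ∧ u = Function.extend w x v then 1 else 0

/-- The projector on the content `y` of the register `w`. -/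
def measOp {N q : ℕ} (w : Fin q ↪ Fin N) (y : Bits q) : Matrix (Qubits N) (Qubits N) ℂ :=
  Matrix.diagonal fun u => if u ∘ w = y then 1 else 0

/-- The Kraus operator, for the content `e` of the other qubits, of tracing out all qubits but
`o`. -/
def keepOp {N : ℕ} (o : Fin N) (e : {j : Fin N // j ≠ o} → Bool) : Matrix Bool (Qubits N) ℂ :=
  Matrix.of fun c v => if v o = c ∧ (fun j : {j : Fin N // j ≠ o} => v j) = e then 1 else 0

lemma sum_loadOp {N p : ℕ} (w : Fin p ↪ Fin N) (x : Bits p) :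
    ∑ z, (loadOp w x z)ᴴ * loadOp w x z = 1 := by
  have inj : ∀ v v' : Qubits N, v ∘ w = v' ∘ w →
      Function.extend w x v = Function.extend w x v' → v = v' := by
    intro v v' h1 h2
    funext j
    by_cases hj : ∃ i, w i = j
    · obtain ⟨i, rfl⟩ := hj
      exact congrFun h1 i
    · have h3 := congrFun h2 j
      rwa [Function.extend_apply' _ _ _ hj, Function.extend_apply' _ _ _ hj] at h3
  ext v v'
  simp only [Matrix.sum_apply, Matrix.mul_apply, Matrix.conjTranspose_apply, loadOp,
    Matrix.of_apply]
  rw [Finset.sum_eq_single (v ∘ w), Finset.sum_eq_single (Function.extend w x v)]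
  · by_cases h : v = v'
    · subst h
      simp
    · have h4 : ¬ (v' ∘ w = v ∘ w ∧ Function.extend w x v = Function.extend w x v') :=
        fun h5 => h (inj _ _ h5.1.symm h5.2)
      simp [h, h4]
  · intro u _ hu
    simp [hu]
  · simp
  · intro z _ hz
    simp [Ne.symm hz]
  · simp

lemma sum_measOp {N q : ℕ} (w : Fin q ↪ Fin N) :
    ∑ y, (measOp w y)ᴴ * measOp w y = 1 := by
  ext v v'
  by_cases h : v = v'
  · subst h
    simp [measOp, Matrix.diagonal_conjTranspose, Matrix.sum_apply]
  · simp [measOp, Matrix.diagonal_conjTranspose, Matrix.sum_apply, h]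

lemma sum_keepOp {N : ℕ} (o : Fin N) : ∑ e, (keepOp o e)ᴴ * keepOp o e = 1 := by
  ext v v'
  simp only [Matrix.sum_apply, Matrix.mul_apply, Matrix.conjTranspose_apply, keepOp,
    Matrix.of_apply]
  rw [Finset.sum_eq_single (fun j : {j : Fin N // j ≠ o} => v j), Finset.sum_eq_single (v o)]
  · by_cases h : v = v'
    · subst h
      simp
    · have h4 : ¬ (v' o = v o ∧
          (fun j : {j : Fin N // j ≠ o} => v' j) = fun j : {j : Fin N // j ≠ o} => v j) := by
        rintro ⟨h5, h6⟩
        refine h (funext fun j => ?_)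
        by_cases hj : j = o
        · rw [hj, h5]
        · exact (congrFun h6 ⟨j, hj⟩).symm
      simp [h, h4]
  · intro c _ hc
    simp [Ne.symm hc]
  · simp
  · intro e _ he
    simp [Ne.symm he]
  · simp

/-- One round of a circuit machine on `N` qubits: the incoming `p`-bit message is written into the
register `inp`, the circuit is applied, and the register `outp` is measured to give the outgoing
`q`-bit message. -/
structure CircuitStep (𝒢 : GateSet) (N p q : ℕ) where
  inp : Fin p ↪ Fin N
  outp : Fin q ↪ Fin N
  circuit : Circuit 𝒢 N

/-- The instrument of a circuit round, for messages encoded as bit strings. -/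
def CircuitStep.toInstrument {𝒢 : GateSet} {N p q : ℕ} (C : CircuitStep 𝒢 N p q) {X Y : Type}
    [Fintype Y] (f : X → Bits p) (e : Y ≃ Bits q) : Instrument X Y (Qubits N) (Qubits N) :=
  Instrument.ofKraus
    (fun x y z => measOp C.outp (e y) * C.circuit.unitary.1 * loadOp C.inp (f x) z) fun x => by
    have hU : (C.circuit.unitary.1)ᴴ * C.circuit.unitary.1 = 1 :=
      Matrix.mem_unitaryGroup_iff'.1 C.circuit.unitary.2
    have hM : ∑ y, (measOp C.outp (e y))ᴴ * measOp C.outp (e y) = 1 := by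
      rw [← sum_measOp C.outp]
      exact e.sum_comp fun y => (measOp C.outp y)ᴴ * measOp C.outp y
    rw [Finset.sum_comm, ← sum_loadOp C.inp (f x)]
    refine Finset.sum_congr rfl fun z _ => ?_
    calc _ = (loadOp C.inp (f x) z)ᴴ * ((C.circuit.unitary.1)ᴴ *
          (∑ y, (measOp C.outp (e y))ᴴ * measOp C.outp (e y)) * C.circuit.unitary.1) *
            loadOp C.inp (f x) z := by
          simp only [Matrix.conjTranspose_mul, Finset.mul_sum, Finset.sum_mul, Matrix.mul_assoc]
      _ = _ := by rw [hM, Matrix.mul_one, hU, Matrix.mul_one]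

/-- The channel that applies a circuit and then keeps only the qubit `o`. -/
def Circuit.toChannel {𝒢 : GateSet} {N : ℕ} (C : Circuit 𝒢 N) (o : Fin N) :
    Instrument Unit Unit (Qubits N) Bool :=
  Instrument.ofKraus (fun _ _ e => keepOp o e * C.unitary.1) fun _ => by
    have hU : (C.unitary.1)ᴴ * C.unitary.1 = 1 := Matrix.mem_unitaryGroup_iff'.1 C.unitary.2
    calc _ = (C.unitary.1)ᴴ * (∑ e, (keepOp o e)ᴴ * keepOp o e) * C.unitary.1 := by
          simp [Matrix.conjTranspose_mul, Finset.mul_sum, Finset.sum_mul, Matrix.mul_assoc]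
      _ = _ := by rw [sum_keepOp, Matrix.mul_one, hU]

/-- `|0…0⟩⟨0…0|`. -/
def zeroState (N : ℕ) : State (Qubits N) where
  mat := Matrix.diagonal fun u => if u = fun _ => false then 1 else 0
  posSemidef := Matrix.PosSemidef.diagonal fun u => by
    by_cases h : u = fun _ => false <;> simp [h]
  trace_eq_one := by simp [Matrix.trace_diagonal]

/-- Angles as 3-bit strings. -/
def angleBits : Angle ≃ Bits 3 :=
  Equiv.ofBijective (fun t j => t.val.testBit j) (by decide)

/-- Bits as 1-bit strings. -/
def boolBits : Bool ≃ Bits 1 := (Equiv.funUnique (Fin 1) Bool).symm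

/-- `k` circuit rounds with messages of `l` bits. -/
def circuitMachine {𝒢 : GateSet} {N k l : ℕ} (C : Fin k → CircuitStep 𝒢 N l l) :
    Machine k (Bits l) (Bits l) where
  mem _ := Qubits N
  memFintype _ := inferInstance
  step i := (C i).toInstrument id (Equiv.refl _)

/-- A server given by quantum circuits on `width` qubits. -/
structure CircuitServer (𝒢 : GateSet) (k l : ℕ) where
  width : ℕ
  step : Fin k → CircuitStep 𝒢 width l l
  final : Circuit 𝒢 width
  outWire : Fin width

def CircuitServer.toServer {𝒢 : GateSet} {k l : ℕ} (C : CircuitServer 𝒢 k l) : Server k l where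
  toMachine := circuitMachine C.step
  init := zeroState C.width
  final := C.final.toChannel C.outWire

/-- Size: qubits, rounds and gates. -/
def CircuitServer.size {𝒢 : GateSet} {k l : ℕ} (C : CircuitServer 𝒢 k l) : ℕ :=
  C.width + k + ∑ i, (C.step i).circuit.gates.length + C.final.gates.length

/-- A distinguisher given by quantum circuits on `width` qubits. -/
structure CircuitDistinguisher (𝒢 : GateSet) (k l : ℕ) where
  width : ℕ
  start : CircuitStep 𝒢 width 0 3
  step : Fin k → CircuitStep 𝒢 width l l
  reply : CircuitStep 𝒢 width 3 1
  finish : CircuitStep 𝒢 width 1 1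

def CircuitDistinguisher.toDistinguisher {𝒢 : GateSet} {k l : ℕ}
    (C : CircuitDistinguisher 𝒢 k l) : Distinguisher k l where
  toMachine := circuitMachine C.step
  pre := Qubits C.width
  preFintype := inferInstance
  init := zeroState C.width
  start := C.start.toInstrument (fun _ => Fin.elim0) angleBits
  mid := Qubits C.width
  midFintype := inferInstance
  reply := C.reply.toInstrument angleBits boolBits
  out := Qubits C.width
  outFintype := inferInstance
  finish := C.finish.toInstrument boolBits boolBits

/-- Size: qubits, rounds and gates. -/
def CircuitDistinguisher.size {𝒢 : GateSet} {k l : ℕ} (C : CircuitDistinguisher 𝒢 k l) : ℕ :=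
  C.width + k + ∑ i, (C.step i).circuit.gates.length + C.start.circuit.gates.length +
    C.reply.circuit.gates.length + C.finish.circuit.gates.length

/-- A distinguisher for the client interface alone, given by quantum circuits. -/
structure CircuitLocalDistinguisher (𝒢 : GateSet) where
  width : ℕ
  start : CircuitStep 𝒢 width 0 3
  finish : CircuitStep 𝒢 width 1 1

def CircuitLocalDistinguisher.toLocalDistinguisher {𝒢 : GateSet}
    (C : CircuitLocalDistinguisher 𝒢) : LocalDistinguisher where
  pre := Qubits C.width
  preFintype := inferInstance
  init := zeroState C.width
  mid := Qubits C.width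
  midFintype := inferInstance
  start := C.start.toInstrument (fun _ => Fin.elim0) angleBits
  out := Qubits C.width
  outFintype := inferInstance
  finish := C.finish.toInstrument boolBits boolBits

/-- Size: qubits and gates. -/
def CircuitLocalDistinguisher.size {𝒢 : GateSet} (C : CircuitLocalDistinguisher 𝒢) : ℕ :=
  C.width + C.start.circuit.gates.length + C.finish.circuit.gates.length

/-- Bounded by a polynomial in the security parameter. -/
def PolyBounded (f : ℕ → ℕ) : Prop := ∃ p : Polynomial ℕ, ∀ n, f n ≤ p.eval n

/-- The server is implemented by (non-uniform) quantum circuits of polynomial size. -/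
def PolySizeServer (𝒢 : GateSet) {k l : ℕ → ℕ} (B : ∀ n, Server (k n) (l n)) : Prop :=
  ∃ C : ∀ n, CircuitServer 𝒢 (k n) (l n),
    PolyBounded (fun n => (C n).size) ∧ ∀ n, B n = (C n).toServer

/-- The (non-uniform) quantum polynomial-time distinguishers. -/
def polyDistinguishers (𝒢 : GateSet) (k l : ℕ → ℕ) : Set (∀ n, Distinguisher (k n) (l n)) :=
  {D | ∃ C : ∀ n, CircuitDistinguisher 𝒢 (k n) (l n),
    PolyBounded (fun n => (C n).size) ∧ ∀ n, D n = (C n).toDistinguisher}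

/-- The (non-uniform) quantum polynomial-time distinguishers for the client interface alone. -/
def polyLocalDistinguishers (𝒢 : GateSet) : Set (ℕ → LocalDistinguisher) :=
  {D | ∃ C : ℕ → CircuitLocalDistinguisher 𝒢,
    PolyBounded (fun n => (C n).size) ∧ ∀ n, D n = (C n).toLocalDistinguisher}

end UBQC

end

noncomputable section

namespace UBQC

/-! ### Positivity and normalisation of interactions -/

/-! A distinguisher owns both interfaces, so it knows `φ` as well as `δ`. It plays the honest server
of the preparation phase, obtains a qubit `ρ`, and measures it in the basis of the angle `δ - φ` or
of the opposite angle `δ - φ + π`, replying with the outcome `s`. In the real protocol `δ - φ = θ +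
rπ` and `ρ` is close to `|+_θ⟩`. Hence `s = r` and `s' = 0` in the first case, and `s' = 1` in the
second, almost surely. The difference of the two expectations of `(-1)^{s'}`, summed over the inputs
`φ = 0` and `φ = π/2`, is therefore close to `4`. This is the `score` (`score_clientResource`,
`le_score_clientResource`). In the ideal world `S_UBQC1` returns nothing to its server side, so the
messages, `δ` and `ρ` are distributed independently of `φ` (`sum_simulatedResource`). The output
`s'` may depend on everything, but it can tell the two orientations of the basis apart only through
`s`, hence only as far as the outcome is biased. One and the same `ρ` would have to be strongly
biased in the basis of `δ` and in that of `δ - π/2`. These are complementary: the two absolute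
biases sum to at most `√2` (`abs_bias_add_abs_bias_le`), so the score is at most `2√2 < 4`
(`score_simulatedResource_le`). To keep the circuits elementary, the measured angle `γ` is fixed in
advance rather than controlled by `δ`. Summing over all `γ` with the signed `weight` recovers the
measurement above (`score_eq_sum_bias`), and `weight_mul_sign` splits the weighted observable into
parity tests. Finitely many tests, 64 in all, thus determine the score, and a constant gap in the
score contradicts negligible advantages (`not_indist_of_parity_tests`). It remains to find the tests
in each class: as instruments (`Server.pr_test`), and as circuits a constant larger than the server
(`exists_circuitDistinguisher`). -/

lemma IsCompletelyPositive.map_posSemidef {ι κ : Type} [Fintype ι] [Fintype κ]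
    {Φ : Matrix ι ι ℂ →ₗ[ℂ] Matrix κ κ ℂ} (hΦ : IsCompletelyPositive Φ) {ρ : Matrix ι ι ℂ}
    (hρ : ρ.PosSemidef) : (Φ ρ).PosSemidef :=
  -- Ordinary positivity is complete positivity with a one-dimensional ancilla.
  (hΦ 1 (ρ.submatrix Prod.snd Prod.snd) (hρ.submatrix _)).submatrix fun i : κ => ((0 : Fin 1), i)

lemma IsCompletelyPositive.comp {ι κ ν : Type} {Φ : Matrix ι ι ℂ →ₗ[ℂ] Matrix κ κ ℂ}
    {Ψ : Matrix κ κ ℂ →ₗ[ℂ] Matrix ν ν ℂ} (hΨ : IsCompletelyPositive Ψ)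
    (hΦ : IsCompletelyPositive Φ) : IsCompletelyPositive (Ψ ∘ₗ Φ) :=
  fun m R hR => hΨ m _ (hΦ m R hR)

lemma trace_re_nonneg {ι : Type} [Fintype ι] {ρ : Matrix ι ι ℂ} (h : ρ.PosSemidef) :
    0 ≤ ρ.trace.re :=
  (Complex.nonneg_iff.1 h.trace_nonneg).1

lemma trace_eq_re {ι : Type} [Fintype ι] {ρ : Matrix ι ι ℂ} (h : ρ.PosSemidef) :
    ρ.trace = (ρ.trace.re : ℂ) :=
  Complex.ext rfl (by simpa using (Complex.nonneg_iff.1 h.trace_nonneg).2.symm)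

lemma Machine.run_posSemidef {k : ℕ} {X Y : Type} [Fintype Y] (W : Machine k X Y)
    {ρ : Matrix (W.mem 0) (W.mem 0) ℂ} (hρ : ρ.PosSemidef) (x : Fin k → X) (y : Fin k → Y)
    (i : Fin (k + 1)) : (W.run ρ x y i).PosSemidef := by
  induction i using Fin.induction with
  | zero => exact hρ
  | succ i ih => exact ((W.step i).cp _ _).map_posSemidef ih

/-- The machine without its first round. -/
def Machine.tail {k : ℕ} {X Y : Type} [Fintype Y] (W : Machine (k + 1) X Y) : Machine k X Y where
  mem i := W.mem i.succ
  memFintype i := W.memFintype i.succ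
  step i := W.step i.succ

/-- `run` unfolds from the last round, while the normalisation of an interaction is an induction
that peels off the first. -/
lemma Machine.run_succ {k : ℕ} {X Y : Type} [Fintype Y] (W : Machine (k + 1) X Y)
    (ρ : Matrix (W.mem 0) (W.mem 0) ℂ) (x : Fin (k + 1) → X) (y : Fin (k + 1) → Y)
    (i : Fin (k + 1)) :
    W.run ρ x y i.succ =
      W.tail.run ((W.step 0).op (x 0) (y 0) ρ) (fun j => x j.succ) (fun j => y j.succ) i := by
  induction i using Fin.induction with
  | zero => rfl
  | succ i ih => exact congrArg ((W.step i.succ).op (x i.succ) (y i.succ)) ih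

lemma sum_sum_mul_of_sum_eq {α β : Type} [Fintype α] [Fintype β] {f : α → ℂ} {g : α → β → ℂ}
    {s t : ℂ} (hf : ∑ a, f a = s) (hg : ∀ a, ∑ b, g a b = t) : ∑ a, ∑ b, f a * g a b = s * t := by
  simp_rw [← Finset.mul_sum, hg, ← Finset.sum_mul, hf]

/-- Neither factor is normalised alone, since each machine reads what the other writes. Causality
helps: with the first messages fixed, the rest is a shorter interaction from sub-normalised
memories, and trace preservation of the two first instruments then sums out `b₀` and `a₀` in that
order. The message `x₀` already received is generalised for the induction. -/
lemma sum_trace_run_mul_trace_run {M : Type} [Fintype M] {k : ℕ} (W : Machine k (Option M) M)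
    (V : Machine k M M) (ρ : Matrix (W.mem 0) (W.mem 0) ℂ) (τ : Matrix (V.mem 0) (V.mem 0) ℂ)
    (x₀ : Option M) :
    ∑ a : Fin k → M, ∑ b : Fin k → M,
      (W.run ρ (fun i => (Fin.cons x₀ fun i => some (b i) : Fin (k + 1) → Option M) i.castSucc) a
        (Fin.last k)).trace * (V.run τ a b (Fin.last k)).trace = ρ.trace * τ.trace := by
  induction k generalizing x₀ with
  | zero => simp [Machine.run]
  | succ k ih =>
    rw [← (Fin.consEquiv fun _ => M).sum_comp, Fintype.sum_prod_type]
    have step : ∀ a₀ b₀ : M, ∑ a : Fin k → M, ∑ b : Fin k → M,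
        (W.run ρ (fun i => (Fin.cons x₀ fun i => some ((Fin.cons b₀ b : Fin (k + 1) → M) i) :
          Fin (k + 2) → Option M) i.castSucc) (Fin.cons a₀ a : Fin (k + 1) → M)
          (Fin.last (k + 1))).trace *
        (V.run τ (Fin.cons a₀ a : Fin (k + 1) → M) (Fin.cons b₀ b : Fin (k + 1) → M)
          (Fin.last (k + 1))).trace =
        ((W.step 0).op x₀ a₀ ρ).trace * ((V.step 0).op a₀ b₀ τ).trace := by
      intro a₀ b₀
      -- For the remaining rounds, `b₀` is the message already received.
      refine Eq.trans ?_
        (ih W.tail V.tail ((W.step 0).op x₀ a₀ ρ) ((V.step 0).op a₀ b₀ τ) (some b₀))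
      refine Finset.sum_congr rfl fun a _ => Finset.sum_congr rfl fun b _ => ?_
      rw [← Fin.succ_last, Machine.run_succ, Machine.run_succ]
      congr 3
      funext i
      exact Fin.cases (motive := fun j => some ((Fin.cons b₀ b : Fin (k + 1) → M) j) =
        (Fin.cons (some b₀) fun i => some (b i) : Fin (k + 1) → Option M) j)
        rfl (fun _ => rfl) i.castSucc
    calc _ = ∑ a₀ : M, ∑ b₀ : M,
          ((W.step 0).op x₀ a₀ ρ).trace * ((V.step 0).op a₀ b₀ τ).trace := by
          refine Finset.sum_congr rfl fun a₀ _ => ?_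
          simp_rw [← step]
          conv_rhs => rw [Finset.sum_comm]
          refine Finset.sum_congr rfl fun a _ => ?_
          rw [← (Fin.consEquiv fun _ => M).sum_comp, Fintype.sum_prod_type]
          rfl
      _ = _ := sum_sum_mul_of_sum_eq ((W.step 0).tp x₀ ρ) fun a₀ => (V.step 0).tp a₀ τ

/-! ### Probabilities of transcripts with a server -/

lemma Server.run_posSemidef {k l : ℕ} (B : Server k l) (a b : Fin k → Bits l) :
    (B.run B.init.mat a b (Fin.last k)).PosSemidef :=
  B.toMachine.run_posSemidef B.init.posSemidef a b _

lemma Server.output_posSemidef {k l : ℕ} (B : Server k l) (a b : Fin k → Bits l) :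
    (B.output a b).PosSemidef :=
  (B.final.cp _ _).map_posSemidef (B.run_posSemidef a b)

lemma Server.trace_output {k l : ℕ} (B : Server k l) (a b : Fin k → Bits l) :
    (B.output a b).trace = (B.run B.init.mat a b (Fin.last k)).trace := by
  simpa [Server.output] using B.final.tp () (B.run B.init.mat a b (Fin.last k))

/-- The transcript probabilities of a client-side machine and a server sum to one. -/
lemma sum_trace_run_mul_trace_output {k l : ℕ} (W : Machine k (Option (Bits l)) (Bits l))
    (ω : State (W.mem 0)) (B : Server k l) :
    ∑ a : Fin k → Bits l, ∑ b : Fin k → Bits l,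
      (W.run ω.mat (fun i => received b i.castSucc) a (Fin.last k)).trace.re *
        (B.output a b).trace.re = 1 := by
  have h := sum_trace_run_mul_trace_run W B.toMachine ω.mat B.init.mat none
  rw [ω.trace_eq_one, B.init.trace_eq_one, one_mul] at h
  have h' := congrArg Complex.re h
  simp only [Complex.re_sum, Complex.one_re] at h'
  rw [← h']
  refine Finset.sum_congr rfl fun a _ => Finset.sum_congr rfl fun b _ => ?_
  rw [B.trace_output, trace_eq_re (B.run_posSemidef a b), Complex.re_mul_ofReal,
    Complex.ofReal_re]
  rfl

lemma Client.prob_nonneg {k l : ℕ} (A : Client k l) (b a : Fin k → Bits l) (θ : Angle) :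
    0 ≤ A.prob b a θ :=
  trace_re_nonneg ((A.final.cp _ _).map_posSemidef (A.run_posSemidef A.init.posSemidef _ _ _))

lemma Client.sum_prob {k l : ℕ} (A : Client k l) (b a : Fin k → Bits l) :
    ∑ θ, A.prob b a θ =
      (A.run A.init.mat (fun i => received b i.castSucc) a (Fin.last k)).trace.re := by
  simp only [Client.prob, ← Complex.re_sum, A.final.tp]

lemma sum_runProb {k l : ℕ} (A : Client k l) (B : Server k l) :
    ∑ a : Fin k → Bits l, ∑ b : Fin k → Bits l, ∑ θ, runProb A B a b θ = 1 := by
  simp only [runProb, ← Finset.sum_mul, A.sum_prob]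
  exact sum_trace_run_mul_trace_output A.toMachine A.init B

/-! ### Phases and measurements of a qubit -/

/-- The phase `e^{iθ}`. -/
def phase (θ : Angle) : ℂ := Complex.exp (Complex.I * (θ.val * Real.pi / 4))

lemma phase_eq_pow (θ : Angle) :
    phase θ = Complex.exp (Complex.I * (Real.pi / 4)) ^ θ.val := by
  rw [phase, ← Complex.exp_nat_mul]
  congr 1
  ring

lemma exp_pi_div_four_pow_four : Complex.exp (Complex.I * (Real.pi / 4)) ^ 4 = -1 := by
  rw [← Complex.exp_nat_mul, ← Complex.exp_pi_mul_I]
  congr 1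
  push_cast
  ring

lemma exp_pi_div_four_pow_two : Complex.exp (Complex.I * (Real.pi / 4)) ^ 2 = Complex.I := by
  rw [← Complex.exp_nat_mul]
  convert Complex.exp_pi_div_two_mul_I using 2
  push_cast
  ring

/-- Phases are powers of an eighth root of unity, so the reduction of representatives modulo 8 is
invisible. -/
lemma phase_add (θ η : Angle) : phase (θ + η) = phase θ * phase η := by
  have h8 : Complex.exp (Complex.I * (Real.pi / 4)) ^ 8 = 1 := by
    rw [show 8 = 4 * 2 from rfl, pow_mul, exp_pi_div_four_pow_four]
    norm_num
  rw [phase_eq_pow, phase_eq_pow, phase_eq_pow, ← pow_add, ZMod.val_add]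
  exact (pow_eq_pow_mod _ h8).symm

lemma phase_zero : phase 0 = 1 := by simp [phase]

lemma phase_two : phase 2 = Complex.I := by
  rw [phase_eq_pow]
  exact exp_pi_div_four_pow_two

lemma phase_four : phase 4 = -1 := by
  rw [phase_eq_pow]
  exact exp_pi_div_four_pow_four

lemma norm_phase (θ : Angle) : ‖phase θ‖ = 1 := by
  rw [phase, ← Complex.norm_exp_ofReal_mul_I (θ.val * Real.pi / 4)]
  push_cast
  rw [mul_comm]

lemma star_phase (θ : Angle) : star (phase θ) = phase (-θ) := by
  have h1 : phase θ * phase (-θ) = 1 := by rw [← phase_add, add_neg_cancel, phase_zero]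
  have h2 : phase θ * star (phase θ) = 1 := by
    rw [Complex.star_def, Complex.mul_conj, Complex.normSq_eq_norm_sq, norm_phase]
    simp
  have h3 : phase θ ≠ 0 := fun h => by simp [h] at h1
  exact mul_left_cancel₀ h3 (h2.trans h1.symm)

lemma phase_add_bitAngle (θ : Angle) (s : Bool) :
    phase (θ + bitAngle s) = (if s then -1 else 1) * phase θ := by
  cases s <;> simp [bitAngle, phase_add, phase_four]

/-- `(-1)^b`. -/
def sign (b : Bool) : ℝ := if b then -1 else 1

lemma one_div_sqrt_two_mul_self : (1 / (√2 : ℝ) : ℂ) * (1 / (√2 : ℝ) : ℂ) = 1 / 2 := by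
  rw [div_mul_div_comm, ← Complex.ofReal_mul, Real.mul_self_sqrt (by norm_num)]
  norm_num

lemma phase_mul_star (θ : Angle) : phase θ * star (phase θ) = 1 := by
  rw [star_phase, ← phase_add, add_neg_cancel, phase_zero]

/-! ### Biases of a qubit along the equator -/

lemma plusProj_apply (θ : Angle) (i j : Bool) :
    plusProj θ i j = (if i then phase θ else 1) * star (if j then phase θ else 1) / 2 := by
  have hs : star (1 / (√2 : ℝ) : ℂ) = 1 / (√2 : ℝ) := by simp
  have hk : ∀ b, plusKet θ b = (1 / (√2 : ℝ) : ℂ) * if b then phase θ else 1 := fun _ => rfl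
  rw [plusProj, Matrix.of_apply, hk, hk, star_mul', hs]
  linear_combination
    (if i then phase θ else 1) * star (if j then phase θ else 1) * one_div_sqrt_two_mul_self

lemma trace_plusProj_mul (θ : Angle) (ρ : Matrix Bool Bool ℂ) :
    (plusProj θ * ρ).trace =
      (ρ.trace + (phase θ * ρ false true + star (phase θ) * ρ true false)) / 2 := by
  simp only [Matrix.trace, Matrix.diag, Matrix.mul_apply, Fintype.sum_bool, plusProj_apply,
    if_true, Bool.false_eq_true, if_false, star_one]
  linear_combination ρ true true / 2 * phase_mul_star θ

/-- The difference of the two outcome probabilities for the basis `{|+_θ⟩, |-_θ⟩}`. -/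
def bias (θ : Angle) (ρ : Matrix Bool Bool ℂ) : ℝ :=
  (phase θ * ρ false true + star (phase θ) * ρ true false).re

/-- Reduces all measurement statistics to the trace and to `bias`, which is linear in the state and
changes sign under rotation by `π`. -/
lemma measProb_eq (θ : Angle) (ρ : Matrix Bool Bool ℂ) (s : Bool) :
    measProb θ ρ s = (ρ.trace.re + sign s * bias θ ρ) / 2 := by
  rw [measProb, trace_plusProj_mul, phase_add_bitAngle, bias, sign]
  rw [show (2 : ℂ) = ((2 : ℝ) : ℂ) by norm_num, Complex.div_ofReal_re]
  cases s <;> simp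
  ring

lemma bias_add_bitAngle (θ : Angle) (r : Bool) (ρ : Matrix Bool Bool ℂ) :
    bias (θ + bitAngle r) ρ = sign r * bias θ ρ := by
  rw [bias, bias, phase_add_bitAngle, sign]
  cases r <;> simp
  ring

lemma bias_sub (θ : Angle) (ρ τ : Matrix Bool Bool ℂ) :
    bias θ (ρ - τ) = bias θ ρ - bias θ τ := by
  simp [bias, mul_sub]
  ring

lemma bias_plusProj (θ : Angle) : bias θ (plusProj θ) = 1 := by
  have h : phase θ * plusProj θ false true + star (phase θ) * plusProj θ true false = 1 := by
    simp only [plusProj_apply, if_true, Bool.false_eq_true, if_false, star_one]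
    linear_combination phase_mul_star θ
  rw [bias, h, Complex.one_re]

lemma trace_plusProj (θ : Angle) : (plusProj θ).trace = 1 := by
  simp only [Matrix.trace, Matrix.diag, Fintype.sum_bool, plusProj_apply, if_true,
    Bool.false_eq_true, if_false, star_one]
  linear_combination phase_mul_star θ / 2

lemma plusProj_posSemidef (θ : Angle) : (plusProj θ).PosSemidef := by
  have : plusProj θ = Matrix.vecMulVec (plusKet θ) (star (plusKet θ)) := rfl
  rw [this]
  exact Matrix.posSemidef_vecMulVec_self_star _

/-- A nonnegative determinant bounds the squared off-diagonal entry by the product of the diagonal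
entries; then apply the inequality of arithmetic and geometric means. -/
lemma norm_offDiag_le {ρ : Matrix Bool Bool ℂ} (h : ρ.PosSemidef) :
    2 * ‖ρ false true‖ ≤ ρ.trace.re := by
  have hd := Complex.nonneg_iff.1 h.det_nonneg
  have h1 := Complex.nonneg_iff.1 (h.diag_nonneg (i := false))
  have h2 := Complex.nonneg_iff.1 (h.diag_nonneg (i := true))
  have h3 : ρ true false = star (ρ false true) := (h.1.apply _ _).symm
  have hdet : ρ.det = ρ false false * ρ true true - ρ false true * ρ true false := by
    rw [← Matrix.det_submatrix_equiv_self finTwoEquiv, Matrix.det_fin_two]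
    simp [finTwoEquiv]
  rw [hdet, h3, Complex.star_def, Complex.mul_conj, Complex.normSq_eq_norm_sq] at hd
  have hd' := hd.1
  simp only [Complex.sub_re, Complex.mul_re, ← h1.2, ← h2.2, Complex.ofReal_re] at hd'
  have ht : ρ.trace.re = (ρ false false).re + (ρ true true).re := by
    simp [Matrix.trace, add_comm]
  rw [ht]
  have := norm_nonneg (ρ false true)
  refine abs_le_of_sq_le_sq' ?_ (by linarith [h1.1, h2.1]) |>.2
  nlinarith [sq_nonneg ((ρ false false).re - (ρ true true).re)]

lemma bias_of_isHermitian (θ : Angle) {ρ : Matrix Bool Bool ℂ} (h : ρ.IsHermitian) :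
    bias θ ρ = 2 * (phase θ * ρ false true).re := by
  have h3 : star (phase θ) * ρ true false = star (phase θ * ρ false true) := by
    rw [star_mul', ← h.apply true false]
  rw [bias, h3, Complex.add_re, Complex.star_def, Complex.conj_re]
  ring

lemma abs_bias_le (θ : Angle) {ρ : Matrix Bool Bool ℂ} (h : ρ.PosSemidef) :
    |bias θ ρ| ≤ ρ.trace.re := by
  rw [bias_of_isHermitian θ h.1, abs_mul, abs_two]
  have := Complex.abs_re_le_norm (phase θ * ρ false true)
  rw [norm_mul, norm_phase, one_mul] at this
  linarith [norm_offDiag_le h]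

/-- A qubit cannot have large biases for two complementary bases of the equator. -/
lemma abs_bias_add_abs_bias_le (θ : Angle) {ρ : Matrix Bool Bool ℂ} (h : ρ.PosSemidef) :
    |bias θ ρ| + |bias (θ - 2) ρ| ≤ √2 * ρ.trace.re := by
  -- Rotating by `π/2` exchanges real and imaginary part: the two biases are `2 Re z` and `2 Im z`
  -- for the same `z`.
  have hp : phase (θ - 2) = -Complex.I * phase θ := by
    rw [sub_eq_add_neg, phase_add, ← star_phase, phase_two]
    simp [mul_comm]
  set z := phase θ * ρ false true with hz
  have hn : ‖z‖ = ‖ρ false true‖ := by rw [hz, norm_mul, norm_phase, one_mul]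
  rw [bias_of_isHermitian θ h.1, bias_of_isHermitian _ h.1, hp, mul_assoc, ← hz]
  have him : (-Complex.I * z).re = z.im := by simp
  rw [him, abs_mul, abs_mul, abs_two]
  -- This `√2`, instead of the trivial `2`, is the whole gap between the two worlds.
  have h1 : |z.re| + |z.im| ≤ √2 * ‖z‖ := by
    refine abs_le_of_sq_le_sq' ?_ (by positivity) |>.2
    rw [mul_pow, Real.sq_sqrt (by norm_num), ← Complex.normSq_eq_norm_sq, Complex.normSq_apply]
    nlinarith [sq_nonneg (|z.re| - |z.im|), sq_abs z.re, sq_abs z.im]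
  have h2 := norm_offDiag_le h
  rw [← hn] at h2
  nlinarith [Real.sqrt_nonneg 2]

/-- The Frobenius norm lies in between: it dominates each entry, and its square is the sum of the
squared singular values, at most the square of their sum. -/
lemma norm_entry_le_traceNorm {ι : Type} [Fintype ι] [DecidableEq ι] (X : Matrix ι ι ℂ)
    (i j : ι) : ‖X i j‖ ≤ traceNorm X := by
  set H := Matrix.isHermitian_conjTranspose_mul_self X with hH
  have hpos := (Matrix.posSemidef_conjTranspose_mul_self X)
  have hev : ∀ i, 0 ≤ H.eigenvalues i := fun i => hpos.eigenvalues_nonneg i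
  have hnn : 0 ≤ traceNorm X := Finset.sum_nonneg fun i _ => Real.sqrt_nonneg _
  have htr : (Xᴴ * X).trace = ((∑ i, H.eigenvalues i : ℝ) : ℂ) := by
    rw [H.trace_eq_sum_eigenvalues]
    push_cast
    rfl
  have hfro : (Xᴴ * X).trace = ((∑ b, ∑ a, ‖X a b‖ ^ 2 : ℝ) : ℂ) := by
    simp only [Matrix.trace, Matrix.diag, Matrix.mul_apply, Matrix.conjTranspose_apply]
    push_cast
    refine Finset.sum_congr rfl fun a _ => Finset.sum_congr rfl fun b _ => ?_
    rw [mul_comm, Complex.star_def, Complex.mul_conj, Complex.normSq_eq_norm_sq]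
    push_cast
    rfl
  have heq : ∑ i, H.eigenvalues i = ∑ b, ∑ a, ‖X a b‖ ^ 2 := by
    exact_mod_cast htr.symm.trans hfro
  refine abs_le_of_sq_le_sq' ?_ hnn |>.2
  calc ‖X i j‖ ^ 2 ≤ ∑ a, ‖X a j‖ ^ 2 :=
        Finset.single_le_sum (f := fun a => ‖X a j‖ ^ 2) (fun _ _ => sq_nonneg _)
          (Finset.mem_univ i)
    _ ≤ ∑ b, ∑ a, ‖X a b‖ ^ 2 :=
        Finset.single_le_sum (f := fun b => ∑ a, ‖X a b‖ ^ 2)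
          (fun _ _ => Finset.sum_nonneg fun _ _ => sq_nonneg _) (Finset.mem_univ j)
    _ = ∑ i, √(H.eigenvalues i) ^ 2 := by
        rw [← heq]
        exact Finset.sum_congr rfl fun i _ => (Real.sq_sqrt (hev i)).symm
    _ ≤ traceNorm X ^ 2 :=
        Finset.sum_sq_le_sq_sum_of_nonneg fun i _ => Real.sqrt_nonneg _

/-- The bias is `1` at `|+_θ⟩` and changes by at most the two off-diagonal entries of the
difference, each bounded by the trace norm, which is twice the trace distance. The constant `4` is
crude, but only the limit matters. -/
lemma one_sub_bias_le (θ : Angle) (ρ : Matrix Bool Bool ℂ) :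
    1 - 4 * traceDist ρ (plusProj θ) ≤ bias θ ρ := by
  have h := bias_sub θ ρ (plusProj θ)
  rw [bias_plusProj] at h
  set X := ρ - plusProj θ with hX
  have h1 := norm_entry_le_traceNorm X false true
  have h2 := norm_entry_le_traceNorm X true false
  have h3 : |bias θ X| ≤ ‖X false true‖ + ‖X true false‖ := by
    refine (Complex.abs_re_le_norm _).trans ((norm_add_le _ _).trans_eq ?_)
    rw [norm_mul, norm_mul, norm_star, norm_phase, one_mul, one_mul]
  have h4 := neg_abs_le (bias θ X)
  have h5 : traceDist ρ (plusProj θ) = traceNorm X / 2 := rfl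
  rw [h5]
  linarith

/-! ### The score of a resource -/

lemma measProb_add_four (θ : Angle) (ρ : Matrix Bool Bool ℂ) (s : Bool) :
    measProb (θ + 4) ρ s = measProb θ ρ (!s) := by
  have h := bias_add_bitAngle θ true ρ
  simp only [bitAngle, if_true] at h
  rw [measProb_eq, measProb_eq, h]
  cases s <;> simp [sign]

lemma measProb_nonneg (θ : Angle) {ρ : Matrix Bool Bool ℂ} (h : ρ.PosSemidef) (s : Bool) :
    0 ≤ measProb θ ρ s := by
  have h1 := abs_le.1 (abs_bias_le θ h)
  rw [measProb_eq]
  cases s <;> simp only [sign, if_true, Bool.false_eq_true, if_false] <;> linarith [h1.1, h1.2]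

lemma sum_measProb (θ : Angle) (ρ : Matrix Bool Bool ℂ) :
    ∑ s, measProb θ ρ s = ρ.trace.re := by
  simp only [measProb_eq, Fintype.sum_bool, sign, if_true, Bool.false_eq_true, if_false]
  ring

/-- The expectation of `h δ s'` if the client input is `φ` and the server side runs `B` and measures
its qubit in the basis `{|+_γ⟩, |-_γ⟩}` to obtain its reply. -/
def expect {k l : ℕ} (B : Server k l) (R : Resource k l) (φ γ : Angle) (h : Angle → Bool → ℝ) :
    ℝ :=
  ∑ a : Fin k → Bits l, ∑ b : Fin k → Bits l, ∑ δ : Angle, ∑ s : Bool, ∑ s' : Bool,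
    R φ b s a δ s' * (measProb γ (B.output a b) s * h δ s')

/-- The parity of `s'`, the highest bit of `δ`, and a subset of the two lower bits of `δ`. -/
def parity (u : Bool × Bool) (δ : Angle) (s' : Bool) : Bool :=
  xor s' (xor (δ.val.testBit 2) (xor (u.1 && δ.val.testBit 0) (u.2 && δ.val.testBit 1)))

/-- `1` at `0`, `-1` at `π`, and `0` at the other angles. -/
def weight (δ : Angle) : ℝ := if δ = 0 then 1 else if δ = 4 then -1 else 0

lemma sign_eq (b : Bool) : sign b = 1 - 2 * (if b then 1 else 0) := by
  cases b <;> norm_num [sign]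

/-- Fourier expansion over the two lower bits. The weight vanishes unless these bits agree in `δ`
and `c`, an event whose indicator is the average of four products of characters; on it, the highest
bits give the sign. A signed observable thus becomes a combination of yes/no tests that CNOT gates
can compute. -/
lemma weight_mul_sign (c δ : Angle) (s' : Bool) :
    weight (δ - c) * sign s' =
      ∑ u, sign (parity u c false) / 4 * (1 - 2 * if parity u δ s' then 1 else 0) := by
  -- Cleared of the denominator, the identity is a finite check over the integers.
  have key : ∀ (c δ : Angle) (s' : Bool),
      4 * ((if δ - c = 0 then 1 else if δ - c = 4 then -1 else 0) * if s' then -1 else 1 : ℤ) =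
        ∑ u, (if parity u c false then -1 else 1) * if parity u δ s' then -1 else 1 := by
    decide +kernel
  have h := congrArg (Int.cast : ℤ → ℝ) (key c δ s')
  push_cast at h
  have h' : 4 * (weight (δ - c) * sign s') =
      ∑ u, sign (parity u c false) * sign (parity u δ s') := h
  simp only [← sign_eq]
  simp only [div_mul_eq_mul_div, ← Finset.sum_div]
  linarith

lemma expect_sum {k l : ℕ} (B : Server k l) (R : Resource k l) (φ γ : Angle) {U : Type} [Fintype U]
    (c : U → ℝ) (h : U → Angle → Bool → ℝ) :
    expect B R φ γ (fun δ s' => ∑ u, c u * h u δ s') = ∑ u, c u * expect B R φ γ (h u) := by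
  simp only [expect, Finset.mul_sum]
  simp only [Finset.sum_comm (s := (Finset.univ : Finset U))]
  refine Finset.sum_congr rfl fun _ _ => Finset.sum_congr rfl fun _ _ => Finset.sum_congr rfl
    fun _ _ => Finset.sum_congr rfl fun _ _ => Finset.sum_congr rfl fun _ _ =>
    Finset.sum_congr rfl fun _ _ => ?_
  ring

lemma expect_one_sub {k l : ℕ} (B : Server k l) (R : Resource k l) (φ γ : Angle)
    (h : Angle → Bool → ℝ) :
    expect B R φ γ (fun δ s' => 1 - 2 * h δ s') =
      expect B R φ γ (fun _ _ => 1) - 2 * expect B R φ γ h := by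
  simp only [expect, Finset.mul_sum, ← Finset.sum_sub_distrib]
  refine Finset.sum_congr rfl fun _ _ => Finset.sum_congr rfl fun _ _ => Finset.sum_congr rfl
    fun _ _ => Finset.sum_congr rfl fun _ _ => Finset.sum_congr rfl fun _ _ => ?_
  ring

/-- The two client inputs that the distinguishers use. -/
def testInput (i : Bool) : Angle := if i then 2 else 0

/-- The success of the server side, over all tests, in steering the client output. -/
def score {k l : ℕ} (B : Server k l) (R : Resource k l) : ℝ :=
  ∑ i : Bool, ∑ γ : Angle,
    expect B R (testInput i) γ fun δ s' => weight (δ - (γ + testInput i)) * sign s'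

/-- Normalisation makes the constant part of each sign the same for all resources, so that score
differences are combinations of distinguishing advantages. -/
lemma score_eq_sum_expect {k l : ℕ} (B : Server k l) (R : Resource k l)
    (hR : ∀ φ γ, expect B R φ γ (fun _ _ => 1) = 1) :
    score B R = ∑ i : Bool, ∑ γ : Angle, ∑ u,
      sign (parity u (γ + testInput i) false) / 4 *
        (1 - 2 * expect B R (testInput i) γ fun δ s' => if parity u δ s' then 1 else 0) := by
  refine Finset.sum_congr rfl fun i _ => Finset.sum_congr rfl fun γ _ => ?_
  simp only [weight_mul_sign]
  rw [expect_sum B R (testInput i) γ (fun u => sign (parity u (γ + testInput i) false) / 4)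
    (fun u δ s' => 1 - 2 * if parity u δ s' then 1 else 0)]
  simp only [expect_one_sub, hR]

lemma sum_weight_mul (f : Angle → ℝ) (c : Angle) :
    ∑ γ, f γ * weight (c - γ) = f c - f (c + 4) := by
  have h : ∀ γ, weight (c - γ) = (if γ = c then 1 else 0) - if γ = c + 4 then 1 else 0 := by
    intro γ
    have h1 : c - γ = 0 ↔ γ = c := by rw [sub_eq_zero, eq_comm]
    have h2 : c - γ = 4 ↔ γ = c + 4 := by
      clear h1
      revert c γ
      decide
    have h3 : ∀ c : Angle, c ≠ c + 4 := by decide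
    have h4 : (4 : Angle) ≠ 0 := by decide
    simp only [weight, h1, h2]
    by_cases h5 : γ = c
    · subst h5
      simp [h3]
    · by_cases h6 : γ = c + 4 <;> simp [h4, h5, h6]
  simp [h, mul_sub, Finset.sum_sub_distrib]

/-- For a fixed transcript, the sum over `γ` retains only `γ = δ - φ` and the opposite angle, with
opposite weights. The opposite basis swaps the outcomes, so the difference of the two probabilities
of `s` is a signed bias. -/
lemma score_eq_sum_bias {k l : ℕ} (B : Server k l) (R : Resource k l) :
    score B R = ∑ i : Bool, ∑ a : Fin k → Bits l, ∑ b : Fin k → Bits l, ∑ δ : Angle, ∑ s : Bool,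
      ∑ s' : Bool, R (testInput i) b s a δ s' *
        (sign s' * sign s * bias (δ - testInput i) (B.output a b)) := by
  refine Finset.sum_congr rfl fun i _ => ?_
  simp only [expect]
  -- The sum over `γ` moves inwards, past the transcript, `δ`, `s` and `s'`.
  rw [Finset.sum_comm]
  refine Finset.sum_congr rfl fun a _ => ?_
  rw [Finset.sum_comm]
  refine Finset.sum_congr rfl fun b _ => ?_
  rw [Finset.sum_comm]
  refine Finset.sum_congr rfl fun δ _ => ?_
  rw [Finset.sum_comm]
  refine Finset.sum_congr rfl fun s _ => ?_
  rw [Finset.sum_comm]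
  refine Finset.sum_congr rfl fun s' _ => ?_
  rw [← Finset.mul_sum]
  congr 1
  have h := sum_weight_mul (fun γ => measProb γ (B.output a b) s * sign s') (δ - testInput i)
  rw [measProb_add_four, measProb_eq, measProb_eq] at h
  calc _ = ∑ γ, measProb γ (B.output a b) s * sign s' * weight (δ - testInput i - γ) := by
        refine Finset.sum_congr rfl fun γ _ => ?_
        rw [show δ - (γ + testInput i) = δ - testInput i - γ by ring]
        ring
    _ = _ := by
        rw [h]
        cases s <;> simp only [sign, Bool.not_true, Bool.not_false, if_true, Bool.false_eq_true,
          if_false] <;> ring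

/-- The marginal `q` must not depend on `s`, which the resource receives only after the transcript
and `δ`; the outcome probabilities of `s` can then be summed to the trace of the qubit. -/
lemma expect_one {k l : ℕ} (B : Server k l) (R : Resource k l) (φ γ : Angle)
    (q : (Fin k → Bits l) → (Fin k → Bits l) → ℝ)
    (hq : ∀ a b s, ∑ δ, ∑ s', R φ b s a δ s' = q a b)
    (hq1 : ∑ a, ∑ b, q a b * (B.output a b).trace.re = 1) :
    expect B R φ γ (fun _ _ => 1) = 1 := by
  refine Eq.trans ?_ hq1
  refine Finset.sum_congr rfl fun a _ => Finset.sum_congr rfl fun b _ => ?_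
  rw [Finset.sum_comm, ← sum_measProb γ, Finset.mul_sum]
  refine Finset.sum_congr rfl fun s _ => ?_
  simp only [mul_one, ← Finset.sum_mul, hq]

/-! ### The real resource -/

lemma sum_clientResource_mul {k l : ℕ} (A : Client k l) (φ : Angle) (b a : Fin k → Bits l)
    (s : Bool) (f : Angle → Bool → ℝ) :
    ∑ δ, ∑ s', clientResource A φ b s a δ s' * f δ s' =
      ∑ θ, ∑ r, A.prob b a θ / 2 * f (θ + bitAngle r + φ) (xor s r) := by
  simp only [clientResource, Finset.sum_mul]
  rw [Finset.sum_congr rfl fun δ _ => Finset.sum_comm, Finset.sum_comm]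
  refine Finset.sum_congr rfl fun θ _ => ?_
  rw [Finset.sum_congr rfl fun δ _ => Finset.sum_comm, Finset.sum_comm]
  refine Finset.sum_congr rfl fun r _ => ?_
  rw [Fintype.sum_eq_single (θ + bitAngle r + φ), Fintype.sum_eq_single (xor s r)]
  · simp
  · intro s' hs'
    simp [hs']
  · intro δ hδ
    simp [hδ]

lemma expect_one_clientResource {k l : ℕ} (A : Client k l) (B : Server k l) (φ γ : Angle) :
    expect B (clientResource A) φ γ (fun _ _ => 1) = 1 := by
  refine expect_one B _ φ γ _ (fun a b s => ?_)
    (sum_trace_run_mul_trace_output A.toMachine A.init B)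
  have h := sum_clientResource_mul A φ b a s fun _ _ => 1
  simp only [mul_one] at h
  rw [h, ← A.sum_prob]
  refine Finset.sum_congr rfl fun θ _ => ?_
  rw [Fintype.sum_bool]
  ring

lemma sign_xor_mul_sign (s r : Bool) : sign (xor s r) * sign s = sign r := by
  cases s <;> cases r <;> simp [sign]

lemma sign_mul_sign (r : Bool) : sign r * sign r = 1 := by
  cases r <;> simp [sign]

/-- Since `δ - φ = θ + rπ`, the bias acquires a factor `(-1)^r`, which cancels against `(-1)^{s +
s'} = (-1)^r`. The factor `4` counts two client inputs and two replies `s`. -/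
lemma score_clientResource {k l : ℕ} (A : Client k l) (B : Server k l) :
    score B (clientResource A) = 4 * ∑ a : Fin k → Bits l, ∑ b : Fin k → Bits l, ∑ θ,
      A.prob b a θ * bias θ (B.output a b) := by
  have h : ∀ i : Bool, ∀ a b : Fin k → Bits l, ∑ δ : Angle, ∑ s : Bool, ∑ s' : Bool,
      clientResource A (testInput i) b s a δ s' *
        (sign s' * sign s * bias (δ - testInput i) (B.output a b)) =
      2 * ∑ θ, A.prob b a θ * bias θ (B.output a b) := by
    intro i a b
    rw [Finset.sum_comm]
    have hs : ∀ s : Bool, ∑ δ : Angle, ∑ s' : Bool,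
        clientResource A (testInput i) b s a δ s' *
          (sign s' * sign s * bias (δ - testInput i) (B.output a b)) =
        ∑ θ, A.prob b a θ * bias θ (B.output a b) := by
      intro s
      rw [sum_clientResource_mul A (testInput i) b a s
        fun δ s' => sign s' * sign s * bias (δ - testInput i) (B.output a b)]
      refine Finset.sum_congr rfl fun θ _ => ?_
      have hr : ∀ r, A.prob b a θ / 2 * (sign (xor s r) * sign s *
          bias (θ + bitAngle r + testInput i - testInput i) (B.output a b)) =
          A.prob b a θ / 2 * bias θ (B.output a b) := by
        intro r
        rw [add_sub_cancel_right, bias_add_bitAngle, sign_xor_mul_sign, ← mul_assoc (sign r),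
          sign_mul_sign, one_mul]
      rw [Fintype.sum_bool, hr, hr]
      ring
    rw [Fintype.sum_bool, hs, hs]
    ring
  rw [score_eq_sum_bias]
  simp only [h]
  simp only [Fintype.sum_bool, ← Finset.mul_sum]
  ring

lemma bias_smul (θ : Angle) (t : ℝ) (ρ : Matrix Bool Bool ℂ) :
    bias θ ((t : ℂ) • ρ) = t * bias θ ρ := by
  have h : phase θ * ((t : ℂ) • ρ) false true + star (phase θ) * ((t : ℂ) • ρ) true false =
      t * (phase θ * ρ false true + star (phase θ) * ρ true false) := by
    simp only [Matrix.smul_apply, smul_eq_mul]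
    ring
  rw [bias, h, Complex.re_ofReal_mul, bias]

lemma le_bias_output {k l : ℕ} (B : Server k l) (a b : Fin k → Bits l) (θ : Angle) {ε : ℝ}
    (h : traceDist (B.outputState a b) (plusProj θ) ≤ ε) :
    (B.output a b).trace.re * (1 - 4 * ε) ≤ bias θ (B.output a b) := by
  have hpos := B.output_posSemidef a b
  have ht := trace_re_nonneg hpos
  -- On transcripts of trace zero `outputState` has no meaning as a state, but the bias vanishes
  -- there.
  rcases ht.eq_or_lt with h0 | h0
  · have h1 := abs_bias_le θ hpos
    rw [← h0] at h1 ⊢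
    rw [abs_nonpos_iff.1 h1, zero_mul]
  · have hne : (B.output a b).trace ≠ 0 := fun h1 => by simp [h1] at h0
    have h1 : B.output a b = ((B.output a b).trace.re : ℂ) • B.outputState a b := by
      rw [← trace_eq_re hpos, Server.outputState, smul_smul, mul_inv_cancel₀ hne, one_smul]
    have h2 : bias θ (B.output a b) = (B.output a b).trace.re * bias θ (B.outputState a b) := by
      conv_lhs => rw [h1, bias_smul]
    rw [h2]
    refine mul_le_mul_of_nonneg_left ?_ ht
    linarith [one_sub_bias_le θ (B.outputState a b)]

/-- Good runs contribute at least `1 - 4ε` times their probability and bad runs at least `-1` times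
theirs. With `P` the probability of a good run, the total is at least `(2 - 4ε) P - 1`; the bound on
`ε` makes this increasing in `P`. -/
lemma le_score_clientResource {k l : ℕ} (A : Client k l) (B : Server k l) {ε μ : ℝ}
    (hε : ε ≤ 1 / 2)
    (h : 1 - μ ≤ ∑ a : Fin k → Bits l, ∑ b : Fin k → Bits l, ∑ θ : Angle,
      if traceDist (B.outputState a b) (plusProj θ) ≤ ε then runProb A B a b θ else 0) :
    4 * ((2 - 4 * ε) * (1 - μ) - 1) ≤ score B (clientResource A) := by
  rw [score_clientResource]
  refine mul_le_mul_of_nonneg_left ?_ (by norm_num)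
  refine (sub_le_sub_right (mul_le_mul_of_nonneg_left h (by linarith)) 1).trans ?_
  -- Writing `1` as the total probability allows a comparison run by run.
  rw [← sum_runProb A B]
  simp only [Finset.mul_sum, ← Finset.sum_sub_distrib]
  refine Finset.sum_le_sum fun a _ => Finset.sum_le_sum fun b _ => Finset.sum_le_sum fun θ _ => ?_
  have hA := A.prob_nonneg b a θ
  split_ifs with hg
  · have h1 := mul_le_mul_of_nonneg_left (le_bias_output B a b θ hg) hA
    rw [runProb]
    linarith
  · have h1 := mul_le_mul_of_nonneg_left (neg_le_of_abs_le
      (abs_bias_le θ (B.output_posSemidef a b))) hA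
    rw [runProb]
    linarith

/-! ### The simulated resource -/

lemma sum_sUBQC1 {ι : Type} [Fintype ι] (φ : Angle) (ξ : Option (Instrument Angle Bool ι Unit))
    (ρ : Matrix ι ι ℂ) : ∑ s', sUBQC1 φ ξ ρ s' = ρ.trace.re := by
  cases ξ with
  | none => simp only [sUBQC1, ← Finset.mul_sum, sum_measProb, trace_plusProj, Complex.one_re,
      mul_one]
  | some ξ => simp only [sUBQC1, ← Complex.re_sum, ξ.tp]

lemma sUBQC1_nonneg {ι : Type} [Fintype ι] (φ : Angle) (ξ : Option (Instrument Angle Bool ι Unit))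
    {ρ : Matrix ι ι ℂ} (hρ : ρ.PosSemidef) (s' : Bool) : 0 ≤ sUBQC1 φ ξ ρ s' := by
  cases ξ with
  | none => exact mul_nonneg (trace_re_nonneg hρ) (measProb_nonneg φ (plusProj_posSemidef 0) s')
  | some ξ => exact trace_re_nonneg ((ξ.cp φ s').map_posSemidef hρ)

/-- The sub-normalised memory of the simulator after its message `δ`. -/
def Simulator.angleState {k l : ℕ} (σ : Simulator k l) (a b : Fin k → Bits l) (δ : Angle) :
    Matrix σ.mid σ.mid ℂ :=
  σ.sendAngle.op (received b (Fin.last k)) δ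
    (σ.run σ.init.mat (fun i => received b i.castSucc) a (Fin.last k))

lemma Simulator.angleState_posSemidef {k l : ℕ} (σ : Simulator k l) (a b : Fin k → Bits l)
    (δ : Angle) : (σ.angleState a b δ).PosSemidef :=
  (σ.sendAngle.cp _ _).map_posSemidef (σ.run_posSemidef σ.init.posSemidef _ _ _)

lemma Simulator.sum_trace_angleState {k l : ℕ} (σ : Simulator k l) (a b : Fin k → Bits l) :
    ∑ δ, (σ.angleState a b δ).trace.re =
      (σ.run σ.init.mat (fun i => received b i.castSucc) a (Fin.last k)).trace.re := by
  simp only [Simulator.angleState, ← Complex.re_sum, σ.sendAngle.tp]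

lemma simulatedResource_nonneg {k l : ℕ} (σ : Simulator k l) (φ : Angle) (b : Fin k → Bits l)
    (s : Bool) (a : Fin k → Bits l) (δ : Angle) (s' : Bool) :
    0 ≤ simulatedResource σ φ b s a δ s' :=
  Finset.sum_nonneg fun _ _ => sUBQC1_nonneg _ _
    ((σ.finish.cp _ _).map_posSemidef (σ.angleState_posSemidef a b δ)) _

/-- Blindness of the ideal resource: without the client output, neither `φ` nor `s` is left on the
right-hand side. -/
lemma sum_simulatedResource {k l : ℕ} (σ : Simulator k l) (φ : Angle) (b : Fin k → Bits l)
    (s : Bool) (a : Fin k → Bits l) (δ : Angle) :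
    ∑ s', simulatedResource σ φ b s a δ s' = (σ.angleState a b δ).trace.re := by
  simp only [simulatedResource]
  rw [Finset.sum_comm]
  simp only [sum_sUBQC1, ← Complex.re_sum, σ.finish.tp]
  rfl

lemma expect_one_simulatedResource {k l : ℕ} (σ : Simulator k l) (B : Server k l)
    (φ γ : Angle) : expect B (simulatedResource σ) φ γ (fun _ _ => 1) = 1 := by
  refine expect_one B _ φ γ _ (fun a b s => ?_)
    (sum_trace_run_mul_trace_output σ.toMachine σ.init B)
  simp only [sum_simulatedResource, σ.sum_trace_angleState]

/-- The transcript weight is common to both client inputs, so even an output `s'` chosen optimally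
for each input and reply is limited by the biases of one qubit in two complementary bases. -/
lemma score_simulatedResource_le {k l : ℕ} (σ : Simulator k l) (B : Server k l) :
    score B (simulatedResource σ) ≤ 2 * √2 := by
  have h1 : ∀ (i : Bool) (a b : Fin k → Bits l) (δ : Angle) (s : Bool),
      ∑ s', simulatedResource σ (testInput i) b s a δ s' *
        (sign s' * sign s * bias (δ - testInput i) (B.output a b)) ≤
      (σ.angleState a b δ).trace.re * |bias (δ - testInput i) (B.output a b)| := by
    intro i a b δ s
    rw [← sum_simulatedResource σ (testInput i) b s a δ, Finset.sum_mul]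
    refine Finset.sum_le_sum fun s' _ =>
      mul_le_mul_of_nonneg_left ?_ (simulatedResource_nonneg σ _ _ _ _ _ _)
    refine (le_abs_self _).trans_eq ?_
    cases s <;> cases s' <;> simp [sign]
  -- The test inputs `0` and `π/2` give the bases `δ` and `δ - π/2`; the factor `2` is the sum over
  -- `s`.
  have h2 : ∀ (a b : Fin k → Bits l) (δ : Angle), ∑ i : Bool, ∑ s : Bool,
      (σ.angleState a b δ).trace.re * |bias (δ - testInput i) (B.output a b)| ≤
      2 * √2 * ((σ.angleState a b δ).trace.re * (B.output a b).trace.re) := by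
    intro a b δ
    have h3 := mul_le_mul_of_nonneg_left
      (abs_bias_add_abs_bias_le δ (B.output_posSemidef a b))
      (trace_re_nonneg (σ.angleState_posSemidef a b δ))
    simp only [Fintype.sum_bool, testInput, if_true, Bool.false_eq_true, if_false, sub_zero]
    linarith
  rw [score_eq_sum_bias]
  calc _ ≤ ∑ i : Bool, ∑ a : Fin k → Bits l, ∑ b : Fin k → Bits l, ∑ δ : Angle, ∑ s : Bool,
        (σ.angleState a b δ).trace.re * |bias (δ - testInput i) (B.output a b)| :=
        Finset.sum_le_sum fun i _ => Finset.sum_le_sum fun a _ => Finset.sum_le_sum fun b _ =>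
          Finset.sum_le_sum fun δ _ => Finset.sum_le_sum fun s _ => h1 i a b δ s
    _ = ∑ a : Fin k → Bits l, ∑ b : Fin k → Bits l, ∑ δ : Angle, ∑ i : Bool, ∑ s : Bool,
        (σ.angleState a b δ).trace.re * |bias (δ - testInput i) (B.output a b)| := by
        rw [Finset.sum_comm]
        refine Finset.sum_congr rfl fun a _ => ?_
        rw [Finset.sum_comm]
        refine Finset.sum_congr rfl fun b _ => ?_
        rw [Finset.sum_comm]
    _ ≤ ∑ a : Fin k → Bits l, ∑ b : Fin k → Bits l, ∑ δ : Angle,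
        2 * √2 * ((σ.angleState a b δ).trace.re * (B.output a b).trace.re) :=
        Finset.sum_le_sum fun a _ => Finset.sum_le_sum fun b _ => Finset.sum_le_sum fun δ _ =>
          h2 a b δ
    _ = 2 * √2 := by
        simp only [← Finset.mul_sum, ← Finset.sum_mul, σ.sum_trace_angleState]
        rw [sum_trace_run_mul_trace_output σ.toMachine σ.init B, mul_one]

/-! ### The contradiction -/

lemma Negligible.tendsto_zero {ε : ℕ → ℝ} (h : Negligible ε) :
    Filter.Tendsto ε Filter.atTop (nhds 0) := by
  simpa using h 0

lemma abs_sign (b : Bool) : |sign b| = 1 := by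
  cases b <;> simp [sign]

/-- If a class of distinguishers contains the parity tests based on the honest server, then no
simulator is indistinguishable from the client. -/
theorem not_indist_of_parity_tests {k l : ℕ → ℕ} {A : ∀ n, Client (k n) (l n)}
    {B : ∀ n, Server (k n) (l n)} (hAB : CorrectRSP A B)
    {𝒟 : Set (∀ n, Distinguisher (k n) (l n))}
    (h𝒟 : ∀ (i : Bool) (γ : Angle) (u : Bool × Bool), ∃ D ∈ 𝒟, ∀ n (R : Resource (k n) (l n)),
      (D n).pr R = expect (B n) R (testInput i) γ fun δ s' => if parity u δ s' then 1 else 0)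
    (σ : ∀ n, Simulator (k n) (l n)) :
    ¬ Indist 𝒟 (fun n => clientResource (A n)) (fun n => simulatedResource (σ n)) := by
  intro hI
  obtain ⟨ε, μ, hε, hμ, hgood⟩ := hAB
  choose D hD hpr using h𝒟
  choose η hη hle using fun i γ u => hI (D i γ u) (hD i γ u)
  -- A test enters the score with coefficient `±1/4` times `2`, so it contributes at most half of
  -- its advantage.
  have hdiff : ∀ n, score (B n) (clientResource (A n)) - score (B n) (simulatedResource (σ n)) ≤
      ∑ i : Bool, ∑ γ : Angle, ∑ u : Bool × Bool, η i γ u n := by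
    intro n
    rw [score_eq_sum_expect (B n) _ (expect_one_clientResource (A n) (B n)),
      score_eq_sum_expect (B n) _ (expect_one_simulatedResource (σ n) (B n))]
    simp only [← Finset.sum_sub_distrib, ← hpr]
    refine Finset.sum_le_sum fun i _ => Finset.sum_le_sum fun γ _ => Finset.sum_le_sum fun u _ => ?_
    have h1 := hle i γ u n
    have h2 := (abs_nonneg _).trans h1
    rw [← mul_sub]
    refine (le_abs_self _).trans ?_
    rw [abs_mul, abs_div, abs_sign, sub_sub_sub_cancel_left, ← mul_sub, abs_mul, abs_sub_comm]
    norm_num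
    linarith
  -- The lower bound for the simulated score tends to `4`, whereas the upper bound is the constant
  -- `2√2`.
  have hlim : Filter.Tendsto (fun n => 4 * ((2 - 4 * ε n) * (1 - μ n) - 1) -
      ∑ i : Bool, ∑ γ : Angle, ∑ u : Bool × Bool, η i γ u n) Filter.atTop
      (nhds (4 * ((2 - 4 * 0) * (1 - 0) - 1) - ∑ i : Bool, ∑ γ : Angle, ∑ u : Bool × Bool, 0)) := by
    refine Filter.Tendsto.sub ?_ ?_
    · exact ((((hε.tendsto_zero.const_mul 4).const_sub 2).mul
        (hμ.tendsto_zero.const_sub 1)).sub_const 1).const_mul 4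
    · exact tendsto_finsetSum _ fun i _ => tendsto_finsetSum _ fun γ _ =>
        tendsto_finsetSum _ fun u _ => (hη i γ u).tendsto_zero
  have hs2 : √2 < 3 / 2 := by
    rw [Real.sqrt_lt' (by norm_num)]
    norm_num
  have hlt : 2 * √2 <
      4 * ((2 - 4 * 0) * (1 - 0) - 1) - ∑ i : Bool, ∑ γ : Angle, ∑ u : Bool × Bool, (0 : ℝ) := by
    simp only [Finset.sum_const_zero]
    linarith
  obtain ⟨n, hn1, hn2⟩ := ((hlim.eventually_const_lt hlt).and
    (hε.tendsto_zero.eventually_le_const (by norm_num : (0 : ℝ) < 1 / 2))).exists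
  linarith [hdiff n, le_score_clientResource (A n) (B n) hn2 (hgood n),
    score_simulatedResource_le (σ n) (B n)]

/-! ### Unbounded distinguishers -/

lemma sum_plusProj (γ : Angle) : ∑ s, plusProj (γ + bitAngle s) = 1 := by
  have hz := phase_mul_star γ
  ext i j
  simp only [Fintype.sum_bool, Matrix.add_apply, plusProj_apply, phase_add_bitAngle]
  cases i <;> cases j <;> simp
  · norm_num
  · ring
  · ring
  · exact hz

/-- A channel followed by an instrument. -/
def Instrument.precomp {X Y ι κ ν : Type} [Fintype Y] [Fintype ι] [Fintype κ] [Fintype ν]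
    (F : Instrument Unit Unit ι κ) (G : Instrument X Y κ ν) : Instrument X Y ι ν where
  op x y := G.op x y ∘ₗ F.op () ()
  cp x y := (G.cp x y).comp (F.cp () ())
  tp x ρ := (G.tp x _).trans (by simpa using F.tp () ρ)

/-- The instrument with the constant outcome `y₀` that does nothing. -/
def Instrument.const {Y ι : Type} [Fintype Y] [DecidableEq Y] [Fintype ι] (y₀ : Y) :
    Instrument Unit Y ι ι where
  op _ y := if y = y₀ then LinearMap.id else 0
  cp _ y := by
    intro m R hR
    split_ifs
    · exact hR
    · exact Matrix.PosSemidef.zero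
  tp _ ρ := by
    rw [Fintype.sum_eq_single y₀]
    · simp
    · intro y hy
      simp [hy]

/-- The measurement of a qubit in the basis `{|+_γ⟩, |-_γ⟩}`, storing the classical input. -/
def measureAndStore (γ : Angle) : Instrument Angle Bool Bool Angle :=
  Instrument.ofKraus (J := Unit)
    (fun δ s _ => Matrix.of fun t c => if t = δ then star (plusKet (γ + bitAngle s) c) else 0)
    fun δ => by
      rw [← sum_plusProj γ]
      refine Finset.sum_congr rfl fun s _ => ?_
      ext c c'
      simp [Matrix.mul_apply, plusProj]

/-- The measurement of a stored angle that compares its parity with a bit. -/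
def measureParity (u : Bool × Bool) : Instrument Bool Bool Angle Angle :=
  Instrument.ofKraus (J := Unit)
    (fun s' o _ => Matrix.diagonal fun δ => if parity u δ s' = o then 1 else 0)
    fun s' => by
      ext t t'
      by_cases h : t = t'
      · subst h
        cases h' : parity u t s' <;> simp [Matrix.diagonal_conjTranspose, h']
      · simp [Matrix.diagonal_conjTranspose, h]

lemma trace_measureParity_measureAndStore (γ δ : Angle) (u : Bool × Bool) (s s' : Bool)
    (ρ : Matrix Bool Bool ℂ) :
    ((measureParity u).op s' true ((measureAndStore γ).op δ s ρ)).trace.re =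
      measProb γ ρ s * if parity u δ s' then 1 else 0 := by
  have h : ∀ t, ((measureAndStore γ).op δ s ρ) t t =
      if t = δ then (plusProj (γ + bitAngle s) * ρ).trace else 0 := by
    intro t
    by_cases ht : t = δ
    · simp [measureAndStore, Instrument.ofKraus, ht, Matrix.mul_apply, Matrix.trace, plusProj]
      ring
    · simp [measureAndStore, Instrument.ofKraus, ht, Matrix.mul_apply]
  have h2 : ((measureParity u).op s' true ((measureAndStore γ).op δ s ρ)).trace =
      (plusProj (γ + bitAngle s) * ρ).trace * if parity u δ s' then 1 else 0 := by
    generalize (plusProj (γ + bitAngle s) * ρ).trace = p at h ⊢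
    simp only [measureParity, Instrument.ofKraus, Matrix.trace, Matrix.diag, LinearMap.coe_mk,
      AddHom.coe_mk, Finset.univ_unique, Finset.sum_singleton, Matrix.diagonal_conjTranspose,
      Matrix.diagonal_mul, Matrix.mul_diagonal, h]
    rw [Fintype.sum_eq_single δ fun t ht => by simp [ht]]
    cases hp : parity u δ s' <;> simp [hp]
  rw [h2, measProb]
  split_ifs <;> simp

/-- The success probability of a distinguisher sums over all client inputs; those that a test never
chooses carry the zero matrix. -/
lemma Machine.run_zero {k : ℕ} {X Y : Type} [Fintype Y] (W : Machine k X Y) (x : Fin k → X)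
    (y : Fin k → Y) (i : Fin (k + 1)) : W.run 0 x y i = 0 := by
  induction i using Fin.induction with
  | zero => rfl
  | succ i ih =>
    exact (congrArg ((W.step i).op (x i) (y i)) ih).trans (map_zero _)

/-- The parity test based on the honest server. -/
def Server.test {k l : ℕ} (B : Server k l) (i : Bool) (γ : Angle) (u : Bool × Bool) :
    Distinguisher k l where
  toMachine := B.toMachine
  pre := B.mem 0
  preFintype := inferInstance
  init := B.init
  start := Instrument.const (testInput i)
  mid := Angle
  midFintype := inferInstance
  reply := B.final.precomp (measureAndStore γ)
  out := Angle
  outFintype := inferInstance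
  finish := measureParity u

lemma Server.pr_test {k l : ℕ} (B : Server k l) (i : Bool) (γ : Angle) (u : Bool × Bool)
    (R : Resource k l) :
    (B.test i γ u).pr R =
      expect B R (testInput i) γ fun δ s' => if parity u δ s' then 1 else 0 := by
  rw [Distinguisher.pr, Fintype.sum_eq_single (testInput i)]
  · refine Finset.sum_congr rfl fun a _ => Finset.sum_congr rfl fun b _ => Finset.sum_congr rfl
      fun δ _ => Finset.sum_congr rfl fun s _ => Finset.sum_congr rfl fun s' _ => ?_
    rw [← trace_measureParity_measureAndStore]
    have h : (B.test i γ u).start.op () (testInput i) (B.test i γ u).init.mat = B.init.mat := by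
      simp only [Server.test, Instrument.const, if_true]
      rfl
    rw [h]
    rfl
  · intro φ hφ
    have h : (B.test i γ u).start.op () φ (B.test i γ u).init.mat = 0 := by
      simp only [Server.test, Instrument.const, if_neg hφ]
      rfl
    simp [h, Machine.run_zero]

/-! ### Gates on a subset of the wires -/

open Classical in
/-- The operator that acts as `U` on the wires `w` and as the identity on the others. -/
def onWires {m N : ℕ} (w : Fin m ↪ Fin N) (U : Matrix (Qubits m) (Qubits m) ℂ) :
    Matrix (Qubits N) (Qubits N) ℂ :=
  Matrix.of fun x y => if ∀ j, j ∉ Set.range w → x j = y j then U (x ∘ w) (y ∘ w) else 0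

lemma extend_of_notMem {m N : ℕ} (w : Fin m ↪ Fin N) (t : Qubits m) (x : Qubits N) {j : Fin N}
    (hj : j ∉ Set.range w) : Function.extend w t x j = x j :=
  Function.extend_apply' _ _ _ hj

lemma extend_comp_self {m N : ℕ} (w : Fin m ↪ Fin N) (t : Qubits m) (x : Qubits N) :
    Function.extend w t x ∘ w = t :=
  Function.extend_comp w.injective t x

lemma eq_of_comp_eq {m N : ℕ} (w : Fin m ↪ Fin N) {x y : Qubits N}
    (h : ∀ j, j ∉ Set.range w → x j = y j) (h' : x ∘ w = y ∘ w) : x = y := by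
  funext j
  by_cases hj : j ∈ Set.range w
  · obtain ⟨i, rfl⟩ := hj
    exact congrFun h' i
  · exact h j hj

open Classical in
-- Strings that agree with `x` off the wires `w` are parametrised by their content on `w`. This
-- reduces the intermediate sum in a product of two `onWires` operators to a matrix product on `m`
-- qubits.
lemma sum_agree_off {m N : ℕ} (w : Fin m ↪ Fin N) (x : Qubits N) (F : Qubits N → ℂ) :
    ∑ z, (if ∀ j, j ∉ Set.range w → x j = z j then F z else 0) =
      ∑ t : Qubits m, F (Function.extend w t x) := by
  rw [← Finset.sum_filter]
  refine Finset.sum_nbij' (fun z => z ∘ w) (fun t => Function.extend w t x) (by simp) ?_ ?_ ?_ ?_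
  · intro t _
    simp only [Finset.mem_filter, Finset.mem_univ, true_and]
    exact fun j hj => (extend_of_notMem w t x hj).symm
  · intro z hz
    simp only [Finset.mem_filter, Finset.mem_univ, true_and] at hz
    exact eq_of_comp_eq w (fun j hj => (extend_of_notMem w _ x hj).trans (hz j hj))
      (extend_comp_self w _ x)
  · exact fun t _ => extend_comp_self w t x
  · intro z hz
    simp only [Finset.mem_filter, Finset.mem_univ, true_and] at hz
    exact congrArg F (eq_of_comp_eq w (fun j hj => (extend_of_notMem w _ x hj).trans (hz j hj))
      (extend_comp_self w _ x)).symm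

lemma onWires_mul {m N : ℕ} (w : Fin m ↪ Fin N) (U V : Matrix (Qubits m) (Qubits m) ℂ) :
    onWires w (U * V) = onWires w U * onWires w V := by
  classical
  ext x y
  simp only [onWires, Matrix.mul_apply, Matrix.of_apply, ite_mul, zero_mul]
  rw [sum_agree_off w x]
  have h : ∀ t : Qubits m, (∀ j, j ∉ Set.range w → Function.extend w t x j = y j) ↔
      ∀ j, j ∉ Set.range w → x j = y j := fun t =>
    forall₂_congr fun j hj => by rw [extend_of_notMem w t x hj]
  simp only [extend_comp_self, h]
  split_ifs <;> simp

lemma onWires_one {m N : ℕ} (w : Fin m ↪ Fin N) : onWires w 1 = 1 := by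
  ext x y
  by_cases hxy : x = y
  · subst hxy
    simp [onWires]
  · rw [onWires, Matrix.of_apply, Matrix.one_apply_ne hxy]
    split_ifs with h
    · exact Matrix.one_apply_ne fun h' => hxy (eq_of_comp_eq w h h')
    · rfl

lemma onWires_conjTranspose {m N : ℕ} (w : Fin m ↪ Fin N) (U : Matrix (Qubits m) (Qubits m) ℂ) :
    (onWires w U)ᴴ = onWires w Uᴴ := by
  ext x y
  simp only [onWires, Matrix.conjTranspose_apply, Matrix.of_apply, eq_comm (a := y _)]
  split_ifs <;> simp

lemma onWires_onWires {m N M : ℕ} (w : Fin m ↪ Fin N) (v : Fin N ↪ Fin M)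
    (U : Matrix (Qubits m) (Qubits m) ℂ) :
    onWires v (onWires w U) = onWires (w.trans v) U := by
  ext x y
  simp only [onWires, Matrix.of_apply, ← ite_and]
  refine if_congr ⟨fun h j hj => ?_, fun h => ⟨fun j hj => h j ?_, fun j hj => h (v j) ?_⟩⟩ rfl rfl
  · by_cases hj' : j ∈ Set.range v
    · obtain ⟨i, rfl⟩ := hj'
      exact h.2 i fun ⟨i', hi'⟩ => hj ⟨i', by simp [hi']⟩
    · exact h.1 j hj'
  · rintro ⟨i, rfl⟩
    exact hj ⟨w i, rfl⟩
  · rintro ⟨i, hi⟩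
    exact hj ⟨i, v.injective hi⟩

/-- `onWires` for unitaries. -/
def onWiresHom {m N : ℕ} (w : Fin m ↪ Fin N) :
    Matrix.unitaryGroup (Qubits m) ℂ →* Matrix.unitaryGroup (Qubits N) ℂ where
  toFun U := ⟨onWires w U.1, by
    have h : (U.1)ᴴ * U.1 = 1 := Matrix.mem_unitaryGroup_iff'.1 U.2
    rw [Matrix.mem_unitaryGroup_iff', Matrix.star_eq_conjTranspose, onWires_conjTranspose,
      ← onWires_mul, h, onWires_one]⟩
  map_one' := Subtype.ext (onWires_one w)
  map_mul' U V := Subtype.ext (onWires_mul w U.1 V.1)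

lemma isElementary_onWiresHom {𝒢 : GateSet} {m N : ℕ} (w : Fin m ↪ Fin N)
    {U : Matrix.unitaryGroup (Qubits m) ℂ} (hU : U ∈ 𝒢 m) : IsElementary 𝒢 (onWiresHom w U) := by
  refine ⟨m, U, w, hU, fun x y => ⟨fun h => if_pos h, fun h => if_neg ?_⟩⟩
  push Not
  exact h

/-- Allows the server's circuit to run inside a larger register over the same gate set. -/
lemma IsElementary.lift {𝒢 : GateSet} {N M : ℕ} (v : Fin N ↪ Fin M)
    {g : Matrix.unitaryGroup (Qubits N) ℂ} (hg : IsElementary 𝒢 g) :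
    IsElementary 𝒢 (onWiresHom v g) := by
  obtain ⟨m, U, w, hU, h⟩ := hg
  have hg : g.1 = onWires w U.1 := by
    ext x y
    by_cases hxy : ∀ j, j ∉ Set.range w → x j = y j
    · rw [(h x y).1 hxy, onWires, Matrix.of_apply, if_pos hxy]
    · rw [(h x y).2 (by push Not at hxy; exact hxy), onWires, Matrix.of_apply, if_neg hxy]
  have hv : onWiresHom v g = onWiresHom (w.trans v) U :=
    Subtype.ext ((congrArg (onWires v) hg).trans (onWires_onWires w v U.1))
  rw [hv]
  exact isElementary_onWiresHom _ hU

/-- The circuit on the wires `v` of a larger register. -/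
def Circuit.lift {𝒢 : GateSet} {N M : ℕ} (C : Circuit 𝒢 N) (v : Fin N ↪ Fin M) :
    Circuit 𝒢 M where
  gates := C.gates.map (onWiresHom v)
  elementary g hg := by
    obtain ⟨g', hg', rfl⟩ := List.mem_map.1 hg
    exact (C.elementary g' hg').lift v

lemma Circuit.unitary_lift {𝒢 : GateSet} {N M : ℕ} (C : Circuit 𝒢 N) (v : Fin N ↪ Fin M) :
    (C.lift v).unitary.1 = onWires v C.unitary.1 := by
  have h : (C.lift v).unitary = onWiresHom v C.unitary := by
    rw [Circuit.unitary, Circuit.unitary, Circuit.lift, ← List.map_reverse, ← map_list_prod]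
  rw [h]
  rfl

/-- The circuit `C` followed by `C'`. -/
def Circuit.append {𝒢 : GateSet} {N : ℕ} (C C' : Circuit 𝒢 N) : Circuit 𝒢 N where
  gates := C.gates ++ C'.gates
  elementary g hg := (List.mem_append.1 hg).elim (C.elementary g) (C'.elementary g)

lemma Circuit.unitary_append {𝒢 : GateSet} {N : ℕ} (C C' : Circuit 𝒢 N) :
    (C.append C').unitary.1 = C'.unitary.1 * C.unitary.1 := by
  simp [Circuit.unitary, Circuit.append]

/-! ### Ancilla wires -/

/-- The isometry that adds wires in the basis state `e`. -/
def ancilla {r : ℕ} (N : ℕ) (e : Qubits r) : Matrix (Qubits (N + r)) (Qubits N) ℂ :=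
  Matrix.of fun u x => if u = Fin.append x e then 1 else 0

lemma exists_eq_append {N r : ℕ} (u : Qubits (N + r)) :
    ∃ (x : Qubits N) (e : Qubits r), u = Fin.append x e :=
  ⟨fun i => u (Fin.castAdd r i), fun i => u (Fin.natAdd N i),
    (Fin.append_castAdd_natAdd).symm⟩

lemma append_inj {N r : ℕ} {x y : Qubits N} {e f : Qubits r} :
    (Fin.append x e : Qubits (N + r)) = Fin.append y f ↔ x = y ∧ e = f := by
  refine ⟨fun h => ⟨funext fun i => ?_, funext fun i => ?_⟩, fun h => by rw [h.1, h.2]⟩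
  · simpa using congrFun h (Fin.castAdd r i)
  · simpa using congrFun h (Fin.natAdd N i)

/-- The first `N` of `N + r` wires. -/
abbrev mainWires (N r : ℕ) : Fin N ↪ Fin (N + r) := Fin.castAddEmb r

/-- The last `r` of `N + r` wires. -/
abbrev ancillaWires (N r : ℕ) : Fin r ↪ Fin (N + r) := Fin.natAddEmb N

lemma append_comp_mainWires {N r : ℕ} (x : Qubits N) (e : Qubits r) :
    (Fin.append x e : Qubits (N + r)) ∘ mainWires N r = x := by
  funext i
  simp

lemma append_comp_ancillaWires {N r : ℕ} (x : Qubits N) (e : Qubits r) :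
    (Fin.append x e : Qubits (N + r)) ∘ ancillaWires N r = e := by
  funext i
  simp

lemma agree_off_mainWires {N r : ℕ} (x y : Qubits N) (e f : Qubits r) :
    (∀ j, j ∉ Set.range (mainWires N r) →
      (Fin.append x e : Qubits (N + r)) j = Fin.append y f j) ↔ e = f := by
  constructor
  · intro h
    funext i
    have := h (Fin.natAdd N i) (by
      rintro ⟨j, hj⟩
      have := congrArg Fin.val hj
      simp at this
      omega)
    simpa using this
  · rintro rfl j hj
    induction j using Fin.addCases with
    | left i => exact absurd ⟨i, rfl⟩ hj
    | right i => simp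

lemma agree_off_ancillaWires {N r : ℕ} (x y : Qubits N) (e f : Qubits r) :
    (∀ j, j ∉ Set.range (ancillaWires N r) →
      (Fin.append x e : Qubits (N + r)) j = Fin.append y f j) ↔ x = y := by
  constructor
  · intro h
    funext i
    have := h (Fin.castAdd r i) (by
      rintro ⟨j, hj⟩
      have := congrArg Fin.val hj
      simp at this
      omega)
    simpa using this
  · rintro rfl j hj
    induction j using Fin.addCases with
    | left i => simp
    | right i => exact absurd ⟨i, rfl⟩ hj

lemma mul_ancilla_apply {N r : ℕ} {κ : Type} (K : Matrix κ (Qubits (N + r)) ℂ) (e : Qubits r)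
    (u : κ) (x : Qubits N) : (K * ancilla N e) u x = K u (Fin.append x e) := by
  simp [Matrix.mul_apply, ancilla]

lemma ancilla_mul_apply {N r : ℕ} {κ : Type} (e : Qubits r) (K : Matrix (Qubits N) κ ℂ)
    (x : Qubits N) (f : Qubits r) (y : κ) :
    (ancilla N e * K) (Fin.append x f) y = if f = e then K x y else 0 := by
  simp only [Matrix.mul_apply, ancilla, Matrix.of_apply, append_inj]
  by_cases h : f = e <;> simp [h]

lemma ancilla_apply {N r : ℕ} (e : Qubits r) (x y : Qubits N) (f : Qubits r) :
    ancilla N e (Fin.append x f) y = if x = y ∧ f = e then 1 else 0 := by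
  simp only [ancilla, Matrix.of_apply, append_inj]

/-- One of several intertwining relations that slide the ancilla isometry through a circuit. They
suffice because the ancillas always hold a definite basis state. -/
lemma onWires_mainWires_mul_ancilla {N r : ℕ} (e : Qubits r)
    (g : Matrix (Qubits N) (Qubits N) ℂ) :
    onWires (mainWires N r) g * ancilla N e = ancilla N e * g := by
  ext u x
  obtain ⟨y, f, rfl⟩ := exists_eq_append u
  rw [mul_ancilla_apply, ancilla_mul_apply, onWires, Matrix.of_apply, append_comp_mainWires,
    append_comp_mainWires]
  exact if_congr (agree_off_mainWires _ _ _ _) rfl rfl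

/-- The operator maps the basis state `e` to the basis state `e'`. -/
def MapsBasis {r : ℕ} (g : Matrix (Qubits r) (Qubits r) ℂ) (e e' : Qubits r) : Prop :=
  ∀ x, g x e = if x = e' then 1 else 0

lemma MapsBasis.mul {r : ℕ} {g h : Matrix (Qubits r) (Qubits r) ℂ} {e e' e'' : Qubits r}
    (hg : MapsBasis g e' e'') (hh : MapsBasis h e e') : MapsBasis (g * h) e e'' := by
  intro x
  simp [Matrix.mul_apply, hh _, hg x]

lemma MapsBasis.one {r : ℕ} (e : Qubits r) :
    MapsBasis (1 : Matrix (Qubits r) (Qubits r) ℂ) e e :=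
  fun _ => Matrix.one_apply

lemma MapsBasis.onWires {m r : ℕ} (w : Fin m ↪ Fin r) {g : Matrix (Qubits m) (Qubits m) ℂ}
    {e : Qubits r} {t : Qubits m} (hg : MapsBasis g (e ∘ w) t) :
    MapsBasis (onWires w g) e (Function.extend w t e) := by
  intro x
  rw [UBQC.onWires, Matrix.of_apply, hg, ← ite_and]
  refine if_congr ⟨fun h => eq_of_comp_eq w (fun j hj => ?_) ?_, ?_⟩ rfl rfl
  · rw [h.1 j hj, extend_of_notMem w t e hj]
  · rw [h.2, extend_comp_self]
  · rintro rfl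
    exact ⟨fun j hj => extend_of_notMem w t e hj, extend_comp_self w t e⟩

lemma onWires_ancillaWires_mul_ancilla {N r : ℕ} {e e' : Qubits r}
    {g : Matrix (Qubits r) (Qubits r) ℂ} (hg : MapsBasis g e e') :
    onWires (ancillaWires N r) g * ancilla N e = ancilla N e' := by
  ext u x
  obtain ⟨y, f, rfl⟩ := exists_eq_append u
  rw [mul_ancilla_apply, ancilla_apply, onWires, Matrix.of_apply, append_comp_ancillaWires,
    append_comp_ancillaWires, hg, ← ite_and]
  exact if_congr (and_congr (agree_off_ancillaWires _ _ _ _) Iff.rfl) rfl rfl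

/-! ### Loading and measuring registers beside ancilla wires -/

lemma extend_append_main {N r p : ℕ} (w : Fin p ↪ Fin N) (t : Bits p) (x : Qubits N)
    (e : Qubits r) :
    Function.extend (w.trans (mainWires N r)) t (Fin.append x e : Qubits (N + r)) =
      Fin.append (Function.extend w t x) e := by
  refine eq_of_comp_eq (w.trans (mainWires N r)) (fun j hj => ?_) ?_
  · rw [extend_of_notMem _ _ _ hj]
    induction j using Fin.addCases with
    | left i =>
      have hi : i ∉ Set.range w := fun ⟨i', hi'⟩ => hj ⟨i', by simp [hi']⟩
      simp [extend_of_notMem _ _ _ hi]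
    | right i => simp
  · rw [extend_comp_self]
    funext i
    simp [w.injective.extend_apply]

lemma extend_append_ancilla {N r p : ℕ} (w : Fin p ↪ Fin r) (t : Bits p) (x : Qubits N)
    (e : Qubits r) :
    Function.extend (w.trans (ancillaWires N r)) t (Fin.append x e : Qubits (N + r)) =
      Fin.append x (Function.extend w t e) := by
  refine eq_of_comp_eq (w.trans (ancillaWires N r)) (fun j hj => ?_) ?_
  · rw [extend_of_notMem _ _ _ hj]
    induction j using Fin.addCases with
    | left i => simp
    | right i =>
      have hi : i ∉ Set.range w := fun ⟨i', hi'⟩ => hj ⟨i', by simp [hi']⟩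
      simp [extend_of_notMem _ _ _ hi]
  · rw [extend_comp_self]
    funext i
    simp [w.injective.extend_apply]

lemma loadOp_main_mul_ancilla {N r p : ℕ} (w : Fin p ↪ Fin N) (t z : Bits p) (e : Qubits r) :
    loadOp (w.trans (mainWires N r)) t z * ancilla N e = ancilla N e * loadOp w t z := by
  ext u x
  obtain ⟨y, f, rfl⟩ := exists_eq_append u
  rw [mul_ancilla_apply, ancilla_mul_apply, loadOp, loadOp, Matrix.of_apply, Matrix.of_apply,
    ← ite_and]
  refine if_congr ?_ rfl rfl
  rw [extend_append_main, append_inj, Function.Embedding.coe_trans, ← Function.comp_assoc,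
    append_comp_mainWires]
  tauto

/-- The old content of the register is definite, so overwriting it has a single nonzero Kraus branch
and leaves the ancillas in a basis state. -/
lemma loadOp_ancilla_mul_ancilla {N r p : ℕ} (w : Fin p ↪ Fin r) (t z : Bits p) (e : Qubits r) :
    loadOp (w.trans (ancillaWires N r)) t z * ancilla N e =
      if e ∘ w = z then ancilla N (Function.extend w t e) else 0 := by
  ext u x
  obtain ⟨y, f, rfl⟩ := exists_eq_append u
  have h : (Fin.append x e : Qubits (N + r)) ∘ w.trans (ancillaWires N r) = e ∘ w := by
    rw [Function.Embedding.coe_trans, ← Function.comp_assoc, append_comp_ancillaWires]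
  simp only [mul_ancilla_apply, loadOp, Matrix.of_apply, extend_append_ancilla, append_inj, h]
  by_cases h : e ∘ w = z
  · simp only [h, true_and, if_true, ancilla_apply]
  · simp [h]

lemma measOp_main_mul_ancilla {N r q : ℕ} (w : Fin q ↪ Fin N) (t : Bits q) (e : Qubits r) :
    measOp (w.trans (mainWires N r)) t * ancilla N e = ancilla N e * measOp w t := by
  ext u x
  obtain ⟨y, f, rfl⟩ := exists_eq_append u
  rw [ancilla_mul_apply, measOp, measOp, Matrix.diagonal_mul, ancilla_apply,
    Function.Embedding.coe_trans, ← Function.comp_assoc, append_comp_mainWires,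
    Matrix.diagonal_apply]
  by_cases h1 : y = x <;> by_cases h2 : f = e <;> simp [h1, h2]

lemma measOp_ancilla_mul_ancilla {N r q : ℕ} (w : Fin q ↪ Fin r) (t : Bits q) (e : Qubits r) :
    measOp (w.trans (ancillaWires N r)) t * ancilla N e =
      if e ∘ w = t then ancilla N e else 0 := by
  ext u x
  obtain ⟨y, f, rfl⟩ := exists_eq_append u
  rw [measOp, Matrix.diagonal_mul, ancilla_apply,
    Function.Embedding.coe_trans, ← Function.comp_assoc, append_comp_ancillaWires]
  by_cases h2 : f = e
  · subst h2
    split_ifs <;> simp_all [ancilla_apply]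
  · split_ifs <;> simp_all [ancilla_apply]

lemma ancilla_conjTranspose_mul_self {N r : ℕ} (e : Qubits r) :
    (ancilla N e)ᴴ * ancilla N e = 1 := by
  ext x y
  rw [mul_ancilla_apply, Matrix.conjTranspose_apply, ancilla_apply, Matrix.one_apply]
  by_cases h : x = y
  · simp [h]
  · simp [h, Ne.symm h]

/-- The state `ρ` with ancilla wires in the basis state `e`. -/
def withAncilla {N r : ℕ} (e : Qubits r) (ρ : Matrix (Qubits N) (Qubits N) ℂ) :
    Matrix (Qubits (N + r)) (Qubits (N + r)) ℂ :=
  ancilla N e * ρ * (ancilla N e)ᴴ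

lemma trace_withAncilla {N r : ℕ} (e : Qubits r) (ρ : Matrix (Qubits N) (Qubits N) ℂ) :
    (withAncilla e ρ).trace = ρ.trace := by
  rw [withAncilla, Matrix.trace_mul_comm, ← Matrix.mul_assoc, ancilla_conjTranspose_mul_self,
    one_mul]

/-- Transfers an intertwining relation for a Kraus operator to density matrices. -/
lemma conj_withAncilla {N r : ℕ} {e e' : Qubits r} {K : Matrix (Qubits (N + r)) (Qubits (N + r)) ℂ}
    {L : Matrix (Qubits N) (Qubits N) ℂ} (h : K * ancilla N e = ancilla N e' * L)
    (ρ : Matrix (Qubits N) (Qubits N) ℂ) :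
    K * withAncilla e ρ * Kᴴ = withAncilla e' (L * ρ * Lᴴ) := by
  calc K * withAncilla e ρ * Kᴴ = (K * ancilla N e) * ρ * (K * ancilla N e)ᴴ := by
        simp only [withAncilla, Matrix.conjTranspose_mul, Matrix.mul_assoc]
    _ = _ := by
        simp only [h, withAncilla, Matrix.conjTranspose_mul, Matrix.mul_assoc]

lemma zeroState_add (N r : ℕ) :
    (zeroState (N + r)).mat = withAncilla (fun _ : Fin r => false) (zeroState N).mat := by
  have hz : (fun _ : Fin (N + r) => false) =
      (Fin.append (fun _ => false) fun _ => false : Qubits (N + r)) := by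
    funext j
    induction j using Fin.addCases <;> simp
  ext u v
  obtain ⟨x, e, rfl⟩ := exists_eq_append u
  obtain ⟨y, f, rfl⟩ := exists_eq_append v
  have h : ∀ N, (zeroState N).mat = Matrix.diagonal fun u => if u = fun _ => false then 1 else 0 :=
    fun _ => rfl
  rw [withAncilla, Matrix.mul_assoc, ancilla_mul_apply, h, h, hz]
  simp only [Matrix.diagonal_mul, Matrix.conjTranspose_apply, ancilla_apply,
    Matrix.diagonal_apply, append_inj]
  by_cases h1 : e = fun _ => false <;> by_cases h2 : f = e <;> by_cases h3 : x = y <;>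
    by_cases h4 : x = fun _ => false <;> simp_all [eq_comm]

/-! ### Circuits for the parity tests -/

/-- A single wire. -/
def oneWire {N : ℕ} (o : Fin N) : Fin 1 ↪ Fin N := ⟨fun _ => o, fun _ _ _ => Subsingleton.elim _ _⟩

lemma oneWire_apply {N : ℕ} (o : Fin N) (j : Fin 1) : oneWire o j = o := rfl

/-! ### Operators on a single wire -/

lemma measOp_refl {m : ℕ} (t : Bits m) :
    measOp (Function.Embedding.refl (Fin m)) t = Matrix.diagonal fun u => if u = t then 1 else 0 :=
  rfl

lemma boolBits_apply (b : Bool) (j : Fin 1) : boolBits b j = b := rfl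

lemma boolBits_symm_apply (x : Bits 1) : boolBits.symm x = x 0 := rfl

lemma agree_off_oneWire {N : ℕ} (o : Fin N) (x y : Qubits N) :
    (∀ j, j ∉ Set.range (oneWire o) → x j = y j) ↔
      (fun j : {j : Fin N // j ≠ o} => x j) = fun j : {j : Fin N // j ≠ o} => y j := by
  have hr : ∀ j, j ∉ Set.range (oneWire o) ↔ j ≠ o := fun j => by
    simp [oneWire_apply, eq_comm]
  simp only [hr, funext_iff, Subtype.forall]

/-- Heisenberg picture of tracing out all wires but `o`: the adjoint of the partial trace sends `P`
to `P ⊗ 1`. -/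
lemma onWires_oneWire {N : ℕ} (o : Fin N) (P : Matrix Bool Bool ℂ) :
    onWires (oneWire o) (P.submatrix boolBits.symm boolBits.symm) =
      ∑ e, (keepOp o e)ᴴ * P * keepOp o e := by
  ext x y
  rw [Matrix.sum_apply, Fintype.sum_eq_single (fun j : {j : Fin N // j ≠ o} => y j)]
  · simp only [onWires, Matrix.of_apply, agree_off_oneWire, Matrix.submatrix_apply,
      boolBits_symm_apply, Matrix.mul_apply, Matrix.conjTranspose_apply, keepOp]
    rw [Fintype.sum_eq_single (y o), Fintype.sum_eq_single (x o)]
    · by_cases h : (fun j : {j : Fin N // j ≠ o} => x j) = fun j : {j : Fin N // j ≠ o} => y j <;>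
        simp [h, oneWire_apply]
    · intro c hc
      simp [hc.symm]
    · intro c hc
      simp [hc.symm]
  · intro e he
    simp [Matrix.mul_apply, keepOp, he.symm]

lemma trace_onWires_oneWire_mul {N : ℕ} (o : Fin N) (P : Matrix Bool Bool ℂ)
    (τ : Matrix (Qubits N) (Qubits N) ℂ) :
    (onWires (oneWire o) (P.submatrix boolBits.symm boolBits.symm) * τ).trace =
      (P * ∑ e, keepOp o e * τ * (keepOp o e)ᴴ).trace := by
  rw [onWires_oneWire, Finset.sum_mul, Finset.mul_sum, Matrix.trace_sum, Matrix.trace_sum]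
  refine Finset.sum_congr rfl fun e _ => ?_
  rw [Matrix.mul_assoc, Matrix.mul_assoc, Matrix.trace_mul_comm]
  simp only [Matrix.mul_assoc]

lemma onWires_measOp {N q : ℕ} (w : Fin q ↪ Fin N) (t : Bits q) :
    onWires w (measOp (Function.Embedding.refl _) t) = measOp w t := by
  ext x y
  by_cases hxy : x = y
  · subst hxy
    rw [onWires, measOp_refl]
    simp [measOp]
  · rw [onWires, Matrix.of_apply, measOp_refl, measOp, Matrix.diagonal_apply_ne _ hxy]
    split_ifs with h
    · exact Matrix.diagonal_apply_ne _ fun h' => hxy (eq_of_comp_eq w h h')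
    · rfl

/-! ### Building blocks from the gates `H`, `T` and CNOT -/

lemma isElementary_of_mem {𝒢 : GateSet} {m : ℕ} {U : Matrix.unitaryGroup (Qubits m) ℂ}
    (hU : U ∈ 𝒢 m) : IsElementary 𝒢 U :=
  ⟨m, U, Function.Embedding.refl _, hU, fun _ _ => ⟨fun _ => rfl, fun ⟨j, hj, _⟩ =>
    absurd ⟨j, rfl⟩ hj⟩⟩

/-- The circuit that repeats a gate of the gate set. -/
def Circuit.replicate {𝒢 : GateSet} {m : ℕ} (U : Matrix.unitaryGroup (Qubits m) ℂ) (hU : U ∈ 𝒢 m)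
    (j : ℕ) : Circuit 𝒢 m where
  gates := List.replicate j U
  elementary g hg := by
    rw [List.eq_of_mem_replicate hg]
    exact isElementary_of_mem hU

lemma Circuit.unitary_replicate {𝒢 : GateSet} {m : ℕ} (U : Matrix.unitaryGroup (Qubits m) ℂ)
    (hU : U ∈ 𝒢 m) (j : ℕ) : (Circuit.replicate U hU j).unitary.1 = U.1 ^ j := by
  simp [Circuit.unitary, Circuit.replicate]

lemma Circuit.length_lift {𝒢 : GateSet} {N M : ℕ} (C : Circuit 𝒢 N) (v : Fin N ↪ Fin M) :
    (C.lift v).gates.length = C.gates.length := by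
  simp [Circuit.lift]

lemma Circuit.length_append {𝒢 : GateSet} {N : ℕ} (C C' : Circuit 𝒢 N) :
    (C.append C').gates.length = C.gates.length + C'.gates.length := by
  simp [Circuit.append]

lemma eq_diagonal_of_tGate {T : Matrix (Qubits 1) (Qubits 1) ℂ}
    (hT : ∀ x y : Qubits 1,
      T x y = if x = y then (if x 0 then Complex.exp (Complex.I * (Real.pi / 4)) else 1) else 0)
    (j : ℕ) : T ^ j = Matrix.diagonal fun x =>
      if x 0 then Complex.exp (Complex.I * (Real.pi / 4)) ^ j else 1 := by
  have h : T = Matrix.diagonal fun x =>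
      if x 0 then Complex.exp (Complex.I * (Real.pi / 4)) else 1 := by
    ext x y
    rw [hT, Matrix.diagonal_apply]
  rw [h, Matrix.diagonal_pow]
  congr 1
  funext x
  rw [Pi.pow_apply]
  split_ifs <;> simp

/-- A rotation after which the computational basis measurement is that of `|±_γ⟩`. -/
lemma exists_circuit_basis {𝒢 : GateSet} (h𝒢 : ContainsCliffordT 𝒢) (γ : Angle) :
    ∃ C : Circuit 𝒢 1, C.gates.length ≤ 8 ∧ ∀ s,
      (measOp (Function.Embedding.refl _) (boolBits s) * C.unitary.1)ᴴ *
        (measOp (Function.Embedding.refl _) (boolBits s) * C.unitary.1) =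
      (plusProj (γ + bitAngle s)).submatrix boolBits.symm boolBits.symm := by
  obtain ⟨H, hH, hH'⟩ := h𝒢.hadamard
  obtain ⟨T, hT, hT'⟩ := h𝒢.tGate
  -- The power of `T` rotates `|±_γ⟩` to `|±⟩`, and `H` maps these to the computational basis. The
  -- exponent is at most 7.
  refine ⟨(Circuit.replicate T hT (-γ).val).append (Circuit.replicate H hH 1), ?_, fun s => ?_⟩
  · have := (-γ).val_lt
    simp only [Circuit.length_append, Circuit.replicate, List.length_replicate]
    omega
  · rw [Circuit.unitary_append, Circuit.unitary_replicate, Circuit.unitary_replicate, pow_one,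
      eq_diagonal_of_tGate hT', ← phase_eq_pow, ← star_phase]
    ext x y
    have hu : ∀ z y : Qubits 1, (measOp (Function.Embedding.refl _) (boolBits s) *
        (H.1 * Matrix.diagonal fun x : Qubits 1 => if x 0 then star (phase γ) else 1)) z y =
        if z = boolBits s then (1 / (√2 : ℝ) : ℂ) * (if s && y 0 then -1 else 1) *
          (if y 0 then star (phase γ) else 1) else 0 := by
      intro z y
      rw [measOp_refl, Matrix.diagonal_mul, Matrix.mul_diagonal, hH']
      by_cases hz : z = boolBits s
      · subst hz
        simp [boolBits_apply]
      · rw [if_neg hz, if_neg hz, zero_mul]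
    rw [Matrix.mul_apply, Fintype.sum_eq_single (boolBits s)]
    · rw [Matrix.conjTranspose_apply, hu, hu, Matrix.submatrix_apply, plusProj_apply,
        boolBits_symm_apply, boolBits_symm_apply, if_pos rfl, if_pos rfl, phase_add_bitAngle]
      have hs : star (1 / (√2 : ℝ) : ℂ) = 1 / (√2 : ℝ) := by simp
      simp only [star_mul', hs]
      have h2 := one_div_sqrt_two_mul_self
      generalize (1 / (√2 : ℝ) : ℂ) = c at h2
      cases s <;> cases x 0 <;> cases y 0 <;> simp <;> first
        | linear_combination h2
        | linear_combination starRingEnd ℂ (phase γ) * h2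
        | linear_combination phase γ * h2
        | linear_combination phase γ * starRingEnd ℂ (phase γ) * h2
        | linear_combination -starRingEnd ℂ (phase γ) * h2
        | linear_combination -phase γ * h2
    · intro z hz
      rw [hu z y, if_neg hz, mul_zero]

/-- The preparation of a test input. -/
lemma exists_circuit_testInput {𝒢 : GateSet} (h𝒢 : ContainsCliffordT 𝒢) (i : Bool) :
    ∃ C : Circuit 𝒢 4, C.gates.length ≤ 6 ∧ ∃ e : Qubits 4,
      MapsBasis C.unitary.1 (fun _ => false) e ∧ e ∘ Fin.castSuccEmb = angleBits (testInput i) := by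
  cases i with
  | false =>
    refine ⟨⟨[], by simp⟩, by simp, fun _ => false, MapsBasis.one _, ?_⟩
    decide
  | true =>
    obtain ⟨H, hH, hH'⟩ := h𝒢.hadamard
    obtain ⟨T, hT, hT'⟩ := h𝒢.tGate
    -- As `T⁴ = Z`, this is `HZH = X` on wire 1, which sets the middle bit: the angle `π/2` is
    -- encoded as binary 010.
    refine ⟨(((Circuit.replicate H hH 1).append (Circuit.replicate T hT 4)).append
      (Circuit.replicate H hH 1)).lift (oneWire 1), by simp [Circuit.length_lift,
        Circuit.length_append, Circuit.replicate],
        Function.extend (oneWire 1) (fun _ => true) (fun _ => false), ?_, ?_⟩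
    · rw [Circuit.unitary_lift]
      refine MapsBasis.onWires _ fun x => ?_
      rw [Circuit.unitary_append, Circuit.unitary_append, Circuit.unitary_replicate,
        Circuit.unitary_replicate, pow_one, eq_diagonal_of_tGate hT', exp_pi_div_four_pow_four,
        Matrix.mul_apply, ← boolBits.sum_comp, Fintype.sum_bool]
      simp only [Matrix.diagonal_mul, hH']
      have hx : x = (fun _ => true) ↔ x 0 = true :=
        ⟨fun h => by rw [h], fun h => funext fun j => by rw [Subsingleton.elim j 0, h]⟩
      have h2 := one_div_sqrt_two_mul_self
      generalize (1 / (√2 : ℝ) : ℂ) = c at h2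
      simp only [hx]
      cases x 0 <;> simp [boolBits_apply]
      linear_combination 2 * h2
    · have he : Function.extend (oneWire (1 : Fin 4)) (fun _ => true) (fun _ => false) =
          fun j => decide (j = 1) := by
        refine eq_of_comp_eq (oneWire 1) (fun j hj => ?_) ?_
        · have hj' : j ≠ 1 := fun h => hj ⟨0, h.symm⟩
          simp [extend_of_notMem _ _ _ hj, hj']
        · rw [extend_comp_self]
          rfl
      rw [he]
      decide

/-- Wire 3 accumulates a parity, and `v` decides whether wire `c` takes part. The other wires keep
their values, so several such circuits can be chained. -/
lemma exists_circuit_cnot {𝒢 : GateSet} (h𝒢 : ContainsCliffordT 𝒢) (v : Bool) {c : Fin 4}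
    (hc : c ≠ 3) : ∃ C : Circuit 𝒢 4, C.gates.length ≤ 1 ∧ ∀ e : Qubits 4, ∃ e' : Qubits 4,
      MapsBasis C.unitary.1 e e' ∧ e' 3 = xor (v && e c) (e 3) ∧ ∀ j, j ≠ 3 → e' j = e j := by
  cases v with
  | false => exact ⟨⟨[], by simp⟩, by simp, fun e => ⟨e, MapsBasis.one _, by simp, fun _ _ => rfl⟩⟩
  | true =>
    obtain ⟨U, hU, hU'⟩ := h𝒢.cnot
    let w : Fin 2 ↪ Fin 4 := ⟨![c, 3], by
      intro a b
      fin_cases a <;> fin_cases b <;> simp [hc, hc.symm]⟩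
    refine ⟨(Circuit.replicate U hU 1).lift w, by simp [Circuit.length_lift, Circuit.replicate],
      fun e => ⟨Function.extend w ![e c, xor (e c) (e 3)] e, ?_, ?_, ?_⟩⟩
    · rw [Circuit.unitary_lift, Circuit.unitary_replicate, pow_one]
      refine MapsBasis.onWires _ fun x => ?_
      rw [hU']
      refine if_congr ?_ rfl rfl
      rw [funext_iff, Fin.forall_fin_two]
      rfl
    · exact w.injective.extend_apply ![e c, xor (e c) (e 3)] e 1
    · intro j hj
      by_cases hjc : j = c
      · rw [hjc]
        exact w.injective.extend_apply ![e c, xor (e c) (e 3)] e 0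
      · refine extend_of_notMem w _ _ ?_
        rintro ⟨a, ha⟩
        fin_cases a
        · exact hjc ha.symm
        · exact hj ha.symm

/-- The computation of the parity. -/
lemma exists_circuit_parity {𝒢 : GateSet} (h𝒢 : ContainsCliffordT 𝒢) (u : Bool × Bool) :
    ∃ C : Circuit 𝒢 4, C.gates.length ≤ 3 ∧ ∀ e : Qubits 4, ∃ e' : Qubits 4,
      MapsBasis C.unitary.1 e e' ∧
        e' 3 = xor (e 3) (xor (e 2) (xor (u.1 && e 0) (u.2 && e 1))) := by
  -- The highest bit of the angle, on wire 2, always enters; `u` selects among the lower two.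
  obtain ⟨C₁, h₁, hC₁⟩ := exists_circuit_cnot h𝒢 true (c := 2) (by decide)
  obtain ⟨C₂, h₂, hC₂⟩ := exists_circuit_cnot h𝒢 u.1 (c := 0) (by decide)
  obtain ⟨C₃, h₃, hC₃⟩ := exists_circuit_cnot h𝒢 u.2 (c := 1) (by decide)
  refine ⟨(C₁.append C₂).append C₃, ?_, fun e => ?_⟩
  · simp only [Circuit.length_append]
    omega
  · obtain ⟨e₁, hm₁, hx₁, hy₁⟩ := hC₁ e
    obtain ⟨e₂, hm₂, hx₂, hy₂⟩ := hC₂ e₁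
    obtain ⟨e₃, hm₃, hx₃, -⟩ := hC₃ e₂
    refine ⟨e₃, ?_, ?_⟩
    · rw [Circuit.unitary_append, Circuit.unitary_append]
      exact hm₃.mul (hm₂.mul hm₁)
    · rw [hx₃, hx₂, hx₁, hy₂ 1 (by decide), hy₁ 1 (by decide), hy₁ 0 (by decide)]
      cases e 3 <;> cases e 2 <;> cases u.1 && e 0 <;> cases u.2 && e 1 <;> rfl

/-! ### Polynomial-size distinguishers -/

/-- The first three of the four ancilla wires. -/
abbrev angleWires : Fin 3 ↪ Fin 4 := Fin.castSuccEmb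

/-- No wire. -/
def noWire {N : ℕ} : Fin 0 ↪ Fin N := ⟨Fin.elim0, fun i => i.elim0⟩

/-- A distinguisher that runs a server on the main wires, measures its qubit after a circuit `M`,
and uses four ancilla wires for the classical data and circuits `S` and `F` on them. -/
def CircuitServer.distinguisher {𝒢 : GateSet} {k l : ℕ} (C : CircuitServer 𝒢 k l)
    (S F : Circuit 𝒢 4) (M : Circuit 𝒢 1) : CircuitDistinguisher 𝒢 k l where
  width := C.width + 4
  start :=
    { inp := noWire.trans (ancillaWires C.width 4)
      outp := angleWires.trans (ancillaWires C.width 4)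
      circuit := S.lift (ancillaWires C.width 4) }
  step i :=
    { inp := (C.step i).inp.trans (mainWires C.width 4)
      outp := (C.step i).outp.trans (mainWires C.width 4)
      circuit := (C.step i).circuit.lift (mainWires C.width 4) }
  reply :=
    { inp := angleWires.trans (ancillaWires C.width 4)
      outp := (oneWire C.outWire).trans (mainWires C.width 4)
      circuit := (C.final.append (M.lift (oneWire C.outWire))).lift (mainWires C.width 4) }
  finish :=
    { inp := (oneWire 3).trans (ancillaWires C.width 4)
      outp := (oneWire 3).trans (ancillaWires C.width 4)
      circuit := F.lift (ancillaWires C.width 4) }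

lemma CircuitServer.size_distinguisher {𝒢 : GateSet} {k l : ℕ} (C : CircuitServer 𝒢 k l)
    (S F : Circuit 𝒢 4) (M : Circuit 𝒢 1) :
    (C.distinguisher S F M).size =
      C.size + 4 + S.gates.length + F.gates.length + M.gates.length := by
  have h : (C.distinguisher S F M).size = C.width + 4 + k +
      ∑ i, ((C.step i).circuit.lift (mainWires C.width 4)).gates.length +
      (S.lift (ancillaWires C.width 4)).gates.length +
      ((C.final.append (M.lift (oneWire C.outWire))).lift (mainWires C.width 4)).gates.length +
      (F.lift (ancillaWires C.width 4)).gates.length := rfl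
  simp only [h, CircuitServer.size, Circuit.length_lift, Circuit.length_append]
  ring

lemma CircuitStep.toInstrument_op {𝒢 : GateSet} {N p q : ℕ} (C : CircuitStep 𝒢 N p q) {X Y : Type}
    [Fintype Y] (f : X → Bits p) (e : Y ≃ Bits q) (x : X) (y : Y)
    (ρ : Matrix (Qubits N) (Qubits N) ℂ) :
    (C.toInstrument f e).op x y ρ =
      ∑ z, (measOp C.outp (e y) * C.circuit.unitary.1 * loadOp C.inp (f x) z) * ρ *
        (measOp C.outp (e y) * C.circuit.unitary.1 * loadOp C.inp (f x) z)ᴴ := rfl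

lemma withAncilla_sum {N r : ℕ} {J : Type} [Fintype J] (e : Qubits r)
    (ρ : J → Matrix (Qubits N) (Qubits N) ℂ) :
    withAncilla e (∑ j, ρ j) = ∑ j, withAncilla e (ρ j) := by
  simp only [withAncilla, Matrix.mul_sum, Matrix.sum_mul]

/-- A round of a circuit on the main wires. -/
lemma toInstrument_op_main {𝒢 : GateSet} {N r p q : ℕ} (C : CircuitStep 𝒢 N p q) {X Y : Type}
    [Fintype Y] (f : X → Bits p) (g : Y ≃ Bits q) (x : X) (y : Y) (e : Qubits r)
    (ρ : Matrix (Qubits N) (Qubits N) ℂ) :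
    (CircuitStep.toInstrument
      { inp := C.inp.trans (mainWires N r), outp := C.outp.trans (mainWires N r),
        circuit := C.circuit.lift (mainWires N r) } f g).op x y (withAncilla e ρ) =
      withAncilla e ((C.toInstrument f g).op x y ρ) := by
  rw [CircuitStep.toInstrument_op, CircuitStep.toInstrument_op, withAncilla_sum]
  refine Finset.sum_congr rfl fun z _ => ?_
  refine conj_withAncilla ?_ ρ
  rw [Matrix.mul_assoc, loadOp_main_mul_ancilla, ← Matrix.mul_assoc, Matrix.mul_assoc (measOp _ _),
    Circuit.unitary_lift, onWires_mainWires_mul_ancilla, ← Matrix.mul_assoc (measOp _ _),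
    measOp_main_mul_ancilla]
  simp only [Matrix.mul_assoc]

/-- A circuit round that reads a message into ancilla wires. -/
lemma toInstrument_op_ancilla {𝒢 : GateSet} {N r p q : ℕ} (w : Fin p ↪ Fin r)
    (v : Fin q ↪ Fin (N + r)) (D : Circuit 𝒢 (N + r)) {X Y : Type}
    [Fintype Y] (f : X → Bits p) (g : Y ≃ Bits q) (x : X) (y : Y) (e e' : Qubits r)
    (L : Matrix (Qubits N) (Qubits N) ℂ)
    (h : measOp v (g y) * D.unitary.1 * ancilla N (Function.extend w (f x) e) = ancilla N e' * L)
    (ρ : Matrix (Qubits N) (Qubits N) ℂ) :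
    (CircuitStep.toInstrument
      { inp := w.trans (ancillaWires N r), outp := v, circuit := D } f g).op x y
        (withAncilla e ρ) = withAncilla e' (L * ρ * Lᴴ) := by
  -- The Kraus operators are indexed by the overwritten content, which is `e ∘ w` with certainty.
  rw [CircuitStep.toInstrument_op, Fintype.sum_eq_single (e ∘ w)]
  · refine conj_withAncilla ?_ ρ
    rw [Matrix.mul_assoc, loadOp_ancilla_mul_ancilla, if_pos rfl, h]
  · intro z hz
    have h0 : (measOp v (g y) * D.unitary.1 * loadOp (w.trans (ancillaWires N r)) (f x) z) *
        ancilla N e = ancilla N e * (0 : Matrix (Qubits N) (Qubits N) ℂ) := by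
      rw [Matrix.mul_assoc, loadOp_ancilla_mul_ancilla, if_neg hz.symm, Matrix.mul_zero,
        Matrix.mul_zero]
    rw [conj_withAncilla h0]
    simp [withAncilla]

section Distinguisher

variable {𝒢 : GateSet} {k l : ℕ} (C : CircuitServer 𝒢 k l) (S F : Circuit 𝒢 4) (M : Circuit 𝒢 1)

/-- As `S` prepares a basis state, the client input read from it is deterministic; the branches of
all other inputs vanish. -/
lemma CircuitServer.distinguisher_start (φ : Angle) {e : Qubits 4}
    (hS : MapsBasis S.unitary.1 (fun _ => false) e) :
    (C.distinguisher S F M).toDistinguisher.start.op () φ (zeroState (C.width + 4)).mat =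
      if e ∘ angleWires = angleBits φ then withAncilla e (zeroState C.width).mat else 0 := by
  have hext : Function.extend (noWire : Fin 0 ↪ Fin 4) Fin.elim0 (fun _ => false) =
      fun _ => false := eq_of_comp_eq noWire (fun j hj => extend_of_notMem _ _ _ hj)
        (Subsingleton.elim _ _)
  have hK : measOp (angleWires.trans (ancillaWires C.width 4)) (angleBits φ) *
      (S.lift (ancillaWires C.width 4)).unitary.1 *
        ancilla C.width (Function.extend (noWire : Fin 0 ↪ Fin 4) Fin.elim0 (fun _ => false)) =
      ancilla C.width e * (if e ∘ angleWires = angleBits φ then 1 else 0 :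
        Matrix (Qubits C.width) (Qubits C.width) ℂ) := by
    rw [hext, Matrix.mul_assoc, Circuit.unitary_lift, onWires_ancillaWires_mul_ancilla hS,
      measOp_ancilla_mul_ancilla]
    split_ifs <;> simp
  rw [zeroState_add]
  refine (toInstrument_op_ancilla noWire _ _ (fun _ => Fin.elim0) angleBits () φ _ e _ hK _).trans ?_
  split_ifs
  · simp
  · simp [withAncilla]

lemma CircuitServer.distinguisher_run (ρ : Matrix (Qubits C.width) (Qubits C.width) ℂ)
    (e : Qubits 4) (a b : Fin k → Bits l) (i : Fin (k + 1)) :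
    (C.distinguisher S F M).toDistinguisher.run (withAncilla e ρ) a b i =
      withAncilla e (C.toServer.run ρ a b i) := by
  induction i using Fin.induction with
  | zero => rfl
  | succ i ih =>
    refine (congrArg (((C.distinguisher S F M).toDistinguisher.step i).op (a i) (b i)) ih).trans ?_
    exact toInstrument_op_main (C.step i) id (Equiv.refl _) (a i) (b i) e _

/-- The wires that held the test input are reused to store `δ`, while the server's final circuit and
the rotation `M` act on the main wires. -/
lemma CircuitServer.distinguisher_reply (δ : Angle) (s : Bool) (e : Qubits 4)
    (ρ : Matrix (Qubits C.width) (Qubits C.width) ℂ) :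
    (C.distinguisher S F M).toDistinguisher.reply.op δ s (withAncilla e ρ) =
      withAncilla (Function.extend angleWires (angleBits δ) e)
        (onWires (oneWire C.outWire) (measOp (Function.Embedding.refl _) (boolBits s) *
            M.unitary.1) * C.final.unitary.1 * ρ *
          (onWires (oneWire C.outWire) (measOp (Function.Embedding.refl _) (boolBits s) *
            M.unitary.1) * C.final.unitary.1)ᴴ) := by
  refine toInstrument_op_ancilla angleWires _ _ angleBits boolBits δ s _ _ _ ?_ ρ
  rw [Matrix.mul_assoc, Circuit.unitary_lift, onWires_mainWires_mul_ancilla, ← Matrix.mul_assoc,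
    measOp_main_mul_ancilla, Circuit.unitary_append, Circuit.unitary_lift, onWires_mul,
    onWires_measOp]
  simp only [Matrix.mul_assoc]

/-- Wire 3 receives `s'` and then the result computed by `F`; its measurement only decides whether
the whole trace is kept. -/
lemma CircuitServer.distinguisher_finish (s' : Bool) (e e' : Qubits 4)
    (hF : MapsBasis F.unitary.1 (Function.extend (oneWire 3) (boolBits s') e) e')
    (ρ : Matrix (Qubits C.width) (Qubits C.width) ℂ) :
    ((C.distinguisher S F M).toDistinguisher.finish.op s' true (withAncilla e ρ)).trace =
      if e' 3 then ρ.trace else 0 := by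
  have hK : measOp ((oneWire 3).trans (ancillaWires C.width 4)) (boolBits true) *
      (F.lift (ancillaWires C.width 4)).unitary.1 *
        ancilla C.width (Function.extend (oneWire 3) (boolBits s') e) =
      ancilla C.width e' * (if e' 3 then 1 else 0 :
        Matrix (Qubits C.width) (Qubits C.width) ℂ) := by
    rw [Matrix.mul_assoc, Circuit.unitary_lift, onWires_ancillaWires_mul_ancilla hF,
      measOp_ancilla_mul_ancilla]
    have h : e' ∘ oneWire 3 = boolBits true ↔ e' 3 = true :=
      ⟨fun h => congrFun h 0, fun h => funext fun _ => h⟩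
    simp only [h]
    split_ifs <;> simp
  refine (congrArg Matrix.trace (toInstrument_op_ancilla (oneWire 3) _ _ boolBits boolBits s' true
    _ e' _ hK ρ)).trans ((trace_withAncilla e' _).trans ?_)
  split_ifs <;> simp

end Distinguisher

/-- The memory of a circuit server after the last message. -/
def CircuitServer.lastState {𝒢 : GateSet} {k l : ℕ} (C : CircuitServer 𝒢 k l)
    (a b : Fin k → Bits l) : Matrix (Qubits C.width) (Qubits C.width) ℂ :=
  C.toServer.run (zeroState C.width).mat a b (Fin.last k)

lemma CircuitServer.output_eq {𝒢 : GateSet} {k l : ℕ} (C : CircuitServer 𝒢 k l)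
    (a b : Fin k → Bits l) :
    C.toServer.output a b = ∑ e, keepOp C.outWire e *
      (C.final.unitary.1 * C.lastState a b * (C.final.unitary.1)ᴴ) * (keepOp C.outWire e)ᴴ := by
  have h : C.toServer.output a b = ∑ e, keepOp C.outWire e * C.final.unitary.1 *
      C.lastState a b * (keepOp C.outWire e * C.final.unitary.1)ᴴ := rfl
  rw [h]
  refine Finset.sum_congr rfl fun e _ => ?_
  simp only [Matrix.conjTranspose_mul, Matrix.mul_assoc]

/-- By cyclicity of the trace only `Mᴴ * M` matters, and its value on one wire can be read off after
the other wires are traced out. -/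
lemma trace_conj_eq_measProb {N : ℕ} (o : Fin N) (M : Matrix (Qubits 1) (Qubits 1) ℂ)
    (U ρ : Matrix (Qubits N) (Qubits N) ℂ) (γ : Angle) (s : Bool)
    (hM : Mᴴ * M = (plusProj (γ + bitAngle s)).submatrix boolBits.symm boolBits.symm) :
    (onWires (oneWire o) M * U * ρ * (onWires (oneWire o) M * U)ᴴ).trace.re =
      measProb γ (∑ e, keepOp o e * (U * ρ * Uᴴ) * (keepOp o e)ᴴ) s := by
  rw [measProb, ← trace_onWires_oneWire_mul, ← hM, onWires_mul, ← onWires_conjTranspose]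
  have h : onWires (oneWire o) M * U * ρ * (onWires (oneWire o) M * U)ᴴ =
      onWires (oneWire o) M * (U * ρ * Uᴴ) * (onWires (oneWire o) M)ᴴ := by
    simp only [Matrix.conjTranspose_mul, Matrix.mul_assoc]
  rw [h, Matrix.trace_mul_comm, ← Matrix.mul_assoc]

lemma angleBits_apply (δ : Angle) (j : Fin 3) : angleBits δ j = δ.val.testBit j := rfl

/-- The parity test is implemented by a circuit that is only slightly larger than the server. -/
lemma exists_circuitDistinguisher {𝒢 : GateSet} (h𝒢 : ContainsCliffordT 𝒢) {k l : ℕ}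
    (C : CircuitServer 𝒢 k l) (i : Bool) (γ : Angle) (u : Bool × Bool) :
    ∃ D : CircuitDistinguisher 𝒢 k l, D.size ≤ C.size + 21 ∧ ∀ R : Resource k l,
      D.toDistinguisher.pr R =
        expect C.toServer R (testInput i) γ fun δ s' => if parity u δ s' then 1 else 0 := by
  obtain ⟨S, hSl, e, hS, he⟩ := exists_circuit_testInput h𝒢 i
  obtain ⟨F, hFl, hF⟩ := exists_circuit_parity h𝒢 u
  obtain ⟨M, hMl, hM⟩ := exists_circuit_basis h𝒢 γ
  refine ⟨C.distinguisher S F M, ?_, fun R => ?_⟩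
  -- The overhead is `21 = 4 + 6 + 3 + 8`: ancilla wires, preparation of the test input, parity, and
  -- basis change.
  · rw [C.size_distinguisher]
    omega
  have hstart : ∀ φ, (C.distinguisher S F M).toDistinguisher.start.op () φ
      (C.distinguisher S F M).toDistinguisher.init.mat =
      if φ = testInput i then withAncilla e (zeroState C.width).mat else 0 := by
    intro φ
    refine (C.distinguisher_start S F M φ hS).trans ?_
    rw [he]
    exact if_congr (angleBits.injective.eq_iff.trans eq_comm) rfl rfl
  rw [Distinguisher.pr, Fintype.sum_eq_single (testInput i)]
  · refine Finset.sum_congr rfl fun a _ => Finset.sum_congr rfl fun b _ => Finset.sum_congr rfl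
      fun δ _ => Finset.sum_congr rfl fun s _ => Finset.sum_congr rfl fun s' _ => ?_
    congr 1
    -- When `F` is applied, the ancillas hold the bits of `δ` on wires 0 to 2 and `s'` on wire 3.
    obtain ⟨e', hm, he'⟩ := hF (Function.extend (oneWire 3) (boolBits s')
      (Function.extend angleWires (angleBits δ) e))
    have hj : ∀ j : Fin 3, Function.extend (oneWire 3) (boolBits s')
        (Function.extend angleWires (angleBits δ) e) j.castSucc = δ.val.testBit j := by
      intro j
      have hj' : j.castSucc ∉ Set.range (oneWire (3 : Fin 4)) := by
        rintro ⟨_, h⟩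
        exact (Fin.castSucc_lt_last j).ne h.symm
      rw [extend_of_notMem _ _ _ hj']
      exact (angleWires.injective.extend_apply (angleBits δ) e j).trans (angleBits_apply δ j)
    have h3 : Function.extend (oneWire 3) (boolBits s')
        (Function.extend angleWires (angleBits δ) e) 3 = s' :=
      (oneWire (3 : Fin 4)).injective.extend_apply (boolBits s') _ 0
    have hpar : e' 3 = parity u δ s' := by
      rw [he', h3]
      exact congrArg _ (congrArg₂ _ (hj 2) (congrArg₂ _ (congrArg _ (hj 0)) (congrArg _ (hj 1))))
    have h1 : (C.distinguisher S F M).toDistinguisher.run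
        ((C.distinguisher S F M).toDistinguisher.start.op () (testInput i)
          (C.distinguisher S F M).toDistinguisher.init.mat) a b (Fin.last k) =
        withAncilla e (C.lastState a b) := by
      rw [hstart, if_pos rfl]
      exact C.distinguisher_run S F M _ e a b _
    have h2 := (congrArg (fun τ => ((C.distinguisher S F M).toDistinguisher.finish.op s' true
      ((C.distinguisher S F M).toDistinguisher.reply.op δ s τ)).trace) h1).trans
      ((congrArg (fun τ => ((C.distinguisher S F M).toDistinguisher.finish.op s' true τ).trace)
        (C.distinguisher_reply S F M δ s e _)).trans (C.distinguisher_finish S F M s' _ e' hm _))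
    refine (congrArg Complex.re h2).trans ?_
    rw [hpar, C.output_eq, ← trace_conj_eq_measProb C.outWire _ C.final.unitary.1 _ γ s (hM s)]
    cases hp : parity u δ s' <;> simp [hp]
  · intro φ hφ
    have h1 : (C.distinguisher S F M).toDistinguisher.run
        ((C.distinguisher S F M).toDistinguisher.start.op () φ
          (C.distinguisher S F M).toDistinguisher.init.mat) = 0 := by
      rw [hstart, if_neg hφ]
      funext a b i
      exact Machine.run_zero _ a b i
    simp only [h1, Pi.zero_apply, map_zero, Matrix.trace_zero, Complex.zero_re, mul_zero,
      Finset.sum_const_zero]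

end UBQC

end

theorem mainTheorem3 (𝒢 : UBQC.GateSet) (h𝒢 : UBQC.ContainsCliffordT 𝒢) (k l : ℕ → ℕ)
    (A : ∀ n, UBQC.Client (k n) (l n)) (B : ∀ n, UBQC.Server (k n) (l n))
    (hAB : UBQC.CorrectRSP A B) :
    (UBQC.PolySizeServer 𝒢 B →
      ¬ ∃ σ : ∀ n, UBQC.Simulator (k n) (l n),
        UBQC.IsComposablyRealizedBy (UBQC.polyLocalDistinguishers 𝒢)
          (UBQC.polyDistinguishers 𝒢 k l) A B σ) ∧
    ¬ ∃ σ : ∀ n, UBQC.Simulator (k n) (l n),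
        UBQC.IsComposablyRealizedBy Set.univ Set.univ A B σ := by
  -- In either setting it suffices to exhibit the parity tests within the class of distinguishers.
  refine ⟨?_, ?_⟩
  · rintro ⟨C, ⟨p, hp⟩, hC⟩ ⟨σ, -, hσ⟩
    refine UBQC.not_indist_of_parity_tests hAB (fun i γ u => ?_) σ hσ
    choose D hDl hD using fun n => UBQC.exists_circuitDistinguisher h𝒢 (C n) i γ u
    refine ⟨fun n => (D n).toDistinguisher, ⟨D, ⟨p + 21, fun n => ?_⟩, fun _ => rfl⟩,
      fun n R => ?_⟩
    · have : (C n).size ≤ p.eval n := hp n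
      have := hDl n
      simp only [Polynomial.eval_add, Polynomial.eval_ofNat]
      omega
    · rw [hC n]
      exact hD n R
  · rintro ⟨σ, -, hσ⟩
    exact UBQC.not_indist_of_parity_tests hAB
      (fun i γ u => ⟨fun n => (B n).test i γ u, Set.mem_univ _, fun n R => (B n).pr_test i γ u R⟩)
      σ hσ
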